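/- Let $q,a\in(0,1)$ and $e\in[0,1]$. Consider the state-dependent memoryless channel with binary input $X$, i.i.d. states $S\sim\mathrm{Bernoulli}(q)$, output $Y=SX$ at the communication receiver (which also knows $S$), and output $Z=aSX+\big((X+N)\bmod 2\big)\in\{0,1,a,a+1\}$ at the sensing receiver, where $N\sim\mathrm{Bernoulli}(e)$ is independent of $(X,S)$; let $d(s,\hat s)=s\oplus\hat s$ be the Hamming distortion. A block-$n$ code sends uniform independent messages $W_0\in\{1,\dots,\lceil 2^{nR_0}\rceil\}$, $W_1\in\{1,\dots,\lceil 2^{nR_1}\rceil\}$ as $x^n(W_0,W_1)$; the communication receiver decodes $(W_0,W_1)$ from $(Y^n,S^n)$, and the sensing receiver decodes $W_0$ and estimates $S^n$ from $Z^n$. A tuple $(R_0,R_1,D)$ with $R_0,R_1\ge 0$ is achievable if for some sequence of such codes the probability that at least one receiver decodes wrongly tends to $0$ and the $\limsup$ of the expected average distortion is at most $D$; the capacity-distortion region is the closure of the set of achievable tuples. Let $(p_{jk})_{j\in\{0,1,2\},k\in\{0,1\}}$ be any joint pmf of $(U,X)$, let $(S,N)$ be independent of $(U,X)$ with $S$ and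 $N$ independent, put $p=P(X=0)$, $\bar q=1-q$, $\bar e=1-e$, $H_2(p)=-p\log_2p-(1-p)\log_2(1-p)$ (information quantities are in bits), and $$D=\sum_{i=0}^{1}\sum_{j=0}^{2}P(Z=i,U=j)\,d_{ij},$$ where, with $\pi_{0j}=\frac{q\bar e p_{j0}}{\bar e p_{j0}+\bar q e p_{j1}}$ and $\pi_{1j}=\frac{q e p_{j0}}{e p_{j0}+\bar q\bar e p_{j1}}$, $d_{ij}=1-\pi_{ij}$ if $\pi_{ij}\ge\frac12$ and $d_{ij}=\pi_{ij}$ otherwise (terms with $P(Z=i,U=j)=0$ are $0$). Then: 1. $I(X;Y|S)=qH_2(p)$, and $D=\mathbb E[d(S,\hat s^*(U,Z))]$ for every optimal one-shot estimator $\hat s^*(u,z)\in\arg\min_{s'}\sum_s P_{S|UZ}(s|u,z)\,d(s,s')$. 2. There are $R_0,R_1\ge0$ with $R_0\le I(U;Z)$, $R_1\le I(X;Y|U,S)$ and $R_0+R_1=\min\{qH_2(p),\,I(U;Z)+I(X;Y|U,S)\}$ such that $(R_0,R_1,D)$ belongs to the capacity-distortion region. 3. Every $(R_0,R_1,D)$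 with $R_0,R_1\ge 0$, $R_0\le I(U;Z)$, $R_1\le I(X;Y|U,S)$ and $R_0+R_1\le\min\{qH_2(p),\,I(U;Z)+I(X;Y|U,S)\}$ belongs to the capacity-distortion region, and $(R_0,R_1,D)$ is itself achievable if $R_0,R_1\ge0$, $R_0<I(U;Z)$, $R_1<I(X;Y|U,S)$ and $R_0+R_1<qH_2(p)$. -/

import Mathlib

namespace ISAC

/-! ## Finite probability and information measures (in bits) -/

open Classical in
/-- The probability of the event `A` under the mass function `P` on a finite space. -/
noncomputable def prob {Ω : Type*} [Fintype Ω] (P : Ω → ℝ) (A : Ω → Prop) : ℝ :=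
  ∑ ω, if A ω then P ω else 0

/-- The expectation of the real random variable `f`. -/
noncomputable def expect {Ω : Type*} [Fintype Ω] (P : Ω → ℝ) (f : Ω → ℝ) : ℝ :=
  ∑ ω, P ω * f ω

/-- `I(A;B) = ∑ P(a,b) log₂ (P(a,b) / (P(a) P(b)))`, a term with `P(a,b) = 0` being `0`. -/
noncomputable def mutualInfo {Ω α β : Type*} [Fintype Ω] [Fintype α] [Fintype β]
    (P : Ω → ℝ) (A : Ω → α) (B : Ω → β) : ℝ :=
  ∑ a, ∑ b, prob P (fun ω => A ω = a ∧ B ω = b) *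
    Real.logb 2 (prob P (fun ω => A ω = a ∧ B ω = b) /
      (prob P (fun ω => A ω = a) * prob P (fun ω => B ω = b)))

/-- `I(A;B|C) = ∑ P(a,b,c) log₂ (P(a,b,c) P(c) / (P(a,c) P(b,c)))`, a term with `P(a,b,c) = 0`
being `0`. -/
noncomputable def condMutualInfo {Ω α β γ : Type*} [Fintype Ω] [Fintype α] [Fintype β]
    [Fintype γ] (P : Ω → ℝ) (A : Ω → α) (B : Ω → β) (C : Ω → γ) : ℝ :=
  ∑ a, ∑ b, ∑ c, prob P (fun ω => A ω = a ∧ B ω = b ∧ C ω = c) *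
    Real.logb 2 (prob P (fun ω => A ω = a ∧ B ω = b ∧ C ω = c) * prob P (fun ω => C ω = c) /
      (prob P (fun ω => A ω = a ∧ C ω = c) * prob P (fun ω => B ω = b ∧ C ω = c)))

/-- The binary entropy function `H₂(p) = -p log₂ p - (1-p) log₂ (1-p)`. -/
noncomputable def H2 (p : ℝ) : ℝ :=
  -p * Real.logb 2 p - (1 - p) * Real.logb 2 (1 - p)

/-! ## The broadcast model with degraded message sets -/

/-- A two-receiver state-dependent memoryless channel: the state law `P_S` and the transition
probabilities `W x s (y, z) = P(y, z | x, s)`. -/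
structure Channel (X S Y Z : Type*) [Fintype S] [Fintype Y] [Fintype Z] where
  PS : S → ℝ
  PS_mem : PS ∈ stdSimplex ℝ S
  W : X → S → Y × Z → ℝ
  W_mem : ∀ x s, W x s ∈ stdSimplex ℝ (Y × Z)

/-- A code of block length `n` with `M₀` common and `M₁` private messages: the encoder,
the decoder of the communication receiver (which sees `yⁿ` and `sⁿ`), the decoder of the sensing
receiver and its state estimator (which see only `zⁿ`). -/
structure Code (X S Y Z : Type*) (M₀ M₁ n : ℕ) where
  enc : Fin M₀ → Fin M₁ → Fin n → X
  dec₁ : (Fin n → Y) → (Fin n → S) → Fin M₀ × Fin M₁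
  dec₂ : (Fin n → Z) → Fin M₀
  est : (Fin n → Z) → Fin n → S

section Operational

variable {X S Y Z : Type*} [Fintype S] [Fintype Y] [Fintype Z]

/-- The expectation of `f W₀ W₁ Sⁿ Yⁿ Zⁿ` when a uniformly distributed message pair is sent with
the code over the memoryless channel with i.i.d. states. -/
noncomputable def Code.average {M₀ M₁ n : ℕ} (c : Code X S Y Z M₀ M₁ n) (ch : Channel X S Y Z)
    (f : Fin M₀ → Fin M₁ → (Fin n → S) → (Fin n → Y) → (Fin n → Z) → ℝ) : ℝ :=
  (1 / ((M₀ : ℝ) * (M₁ : ℝ))) * ∑ w₀, ∑ w₁, ∑ s : Fin n → S, ∑ y : Fin n → Y, ∑ z : Fin n → Z,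
    (∏ i, ch.PS (s i) * ch.W (c.enc w₀ w₁ i) (s i) (y i, z i)) * f w₀ w₁ s y z

open Classical in
/-- The average probability that at least one of the two decoders errs. -/
noncomputable def Code.errorProb {M₀ M₁ n : ℕ} (c : Code X S Y Z M₀ M₁ n)
    (ch : Channel X S Y Z) : ℝ :=
  c.average ch fun w₀ w₁ s y z => if c.dec₁ y s ≠ (w₀, w₁) ∨ c.dec₂ z ≠ w₀ then 1 else 0

/-- The expected average per-block distortion of the state estimator. -/
noncomputable def Code.distortion {M₀ M₁ n : ℕ} (c : Code X S Y Z M₀ M₁ n)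
    (ch : Channel X S Y Z) (d : S → S → ℝ) : ℝ :=
  c.average ch fun _ _ s _ z => (1 / (n : ℝ)) * ∑ i, d (s i) (c.est z i)

/-- `(R₀, R₁, D)` is achievable: there are codes with (at least) `2^(n R₀)` common and
`2^(n R₁)` private messages, vanishing error probability, and asymptotic distortion at most `D`.
(The alphabets are finite, so the distortions form a bounded sequence and the real `limsup` is the
usual one.) -/
def Achievable (ch : Channel X S Y Z) (d : S → S → ℝ) (R₀ R₁ D : ℝ) : Prop :=
  0 ≤ R₀ ∧ 0 ≤ R₁ ∧
    ∃ c : ∀ n : ℕ, Code X S Y Z ⌈(2 : ℝ) ^ ((n : ℝ) * R₀)⌉₊ ⌈(2 : ℝ) ^ ((n : ℝ) * R₁)⌉₊ n,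
      Filter.Tendsto (fun n => (c n).errorProb ch) Filter.atTop (nhds 0) ∧
      Filter.limsup (fun n => (c n).distortion ch d) Filter.atTop ≤ D

/-- The capacity-distortion region: the closure of the set of achievable tuples. -/
def capacityDistortionRegion (ch : Channel X S Y Z) (d : S → S → ℝ) : Set (ℝ × ℝ × ℝ) :=
  closure {t | Achievable ch d t.1 t.2.1 t.2.2}

end Operational

/-! ## Single-letter quantities -/

/-- A realization of the single-letter variables `(U, X, S, Y, Z)`. -/
abbrev Letters (U X S Y Z : Type*) := U × X × S × Y × Z

section SingleLetter

variable {U X S Y Z : Type*}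

/-- The auxiliary variable `U`. -/
def rvU (ω : Letters U X S Y Z) : U := ω.1

/-- The channel input `X`. -/
def rvX (ω : Letters U X S Y Z) : X := ω.2.1

/-- The state `S`. -/
def rvS (ω : Letters U X S Y Z) : S := ω.2.2.1

/-- The output `Y` at the communication receiver. -/
def rvY (ω : Letters U X S Y Z) : Y := ω.2.2.2.1

/-- The output `Z` at the sensing receiver. -/
def rvZ (ω : Letters U X S Y Z) : Z := ω.2.2.2.2

variable [Fintype U] [Fintype X] [Fintype S] [Fintype Y] [Fintype Z]

/-- The joint law `P_{UX} P_S P_{YZ|XS}`. -/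
noncomputable def jointLaw (ch : Channel X S Y Z) (P : U × X → ℝ) : Letters U X S Y Z → ℝ :=
  fun ω => P (rvU ω, rvX ω) * ch.PS (rvS ω) * ch.W (rvX ω) (rvS ω) (rvY ω, rvZ ω)

/-- The posterior probability `P(S = s | U = u, Z = z)`
(`0` if the conditioning event has probability zero). -/
noncomputable def posterior (L : Letters U X S Y Z → ℝ) (s : S) (u : U) (z : Z) : ℝ :=
  prob L (fun ω => rvS ω = s ∧ rvU ω = u ∧ rvZ ω = z) / prob L (fun ω => rvU ω = u ∧ rvZ ω = z)

/-- `g` is an optimal one-shot estimator: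
`g u z ∈ argmin_{s'} ∑_s P(s | u, z) d(s, s')` for all `u`, `z`. -/
def IsOneShotOptimal (L : Letters U X S Y Z → ℝ) (d : S → S → ℝ) (g : U → Z → S) : Prop :=
  ∀ u z s', ∑ s, posterior L s u z * d s (g u z) ≤ ∑ s, posterior L s u z * d s s'

end SingleLetter

/-! ## The binary example -/

/-- The Bernoulli(`r`) mass function: `1 ↦ r`, `0 ↦ 1 - r`. -/
noncomputable def bern (r : ℝ) : Fin 2 → ℝ := ![1 - r, r]

theorem bern_mem {r : ℝ} (hr : r ∈ Set.Icc (0 : ℝ) 1) : bern r ∈ stdSimplex ℝ (Fin 2) := by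
  refine ⟨fun i => ?_, ?_⟩
  · fin_cases i
    · simpa [bern] using hr.2
    · simpa [bern] using hr.1
  · simp [bern]

/-- The alphabet `{0, 1, a, a + 1}` of the sensing receiver. -/
noncomputable def sensingAlphabet (a : ℝ) : Finset ℝ := {0, 1, a, a + 1}

/-- The sensing output `a s x + ((x + ν) mod 2)` for input `x`, state `s` and noise bit `ν`. -/
noncomputable def sensingOutput (a : ℝ) (x s ν : Fin 2) : ↥(sensingAlphabet a) :=
  ⟨a * ((s : ℕ) : ℝ) * ((x : ℕ) : ℝ) + ((((x : ℕ) + (ν : ℕ)) % 2 : ℕ) : ℝ), by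
    fin_cases x <;> fin_cases s <;> fin_cases ν <;> simp [sensingAlphabet]⟩

/-- The transition probabilities of `Y = S X`, `Z = a S X + ((X + N) mod 2)`,
`N ∼ Bernoulli(e)` independent of `(X, S)`. -/
noncomputable def exampleW (a e : ℝ) (x s : Fin 2) (o : Fin 2 × ↥(sensingAlphabet a)) : ℝ :=
  ∑ ν, bern e ν * if o = (s * x, sensingOutput a x s ν) then 1 else 0

theorem exampleW_mem (a : ℝ) {e : ℝ} (he : e ∈ Set.Icc (0 : ℝ) 1) (x s : Fin 2) :
    exampleW a e x s ∈ stdSimplex ℝ (Fin 2 × ↥(sensingAlphabet a)) := by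
  refine ⟨fun o => Finset.sum_nonneg fun ν _ => mul_nonneg ((bern_mem he).1 ν) ?_, ?_⟩
  · split_ifs <;> norm_num
  · unfold exampleW
    rw [Finset.sum_comm]
    refine Eq.trans ?_ (bern_mem he).2
    refine Finset.sum_congr rfl fun ν _ => ?_
    rw [← Finset.mul_sum, Finset.sum_ite_eq' Finset.univ]
    simp

/-- The example channel, with binary `X`, `S`, `Y` and `S ∼ Bernoulli(q)`. -/
noncomputable def exampleChannel (q a e : ℝ) (hq : q ∈ Set.Icc (0 : ℝ) 1)
    (he : e ∈ Set.Icc (0 : ℝ) 1) :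
    Channel (Fin 2) (Fin 2) (Fin 2) ↥(sensingAlphabet a) where
  PS := bern q
  PS_mem := bern_mem hq
  W := exampleW a e
  W_mem := exampleW_mem a he

/-- The Hamming distortion `d(s, ŝ) = s ⊕ ŝ`. -/
noncomputable def hamming (s t : Fin 2) : ℝ := if s = t then 0 else 1

/-- The MAP error `d₀ⱼ` given `Z = 0`, `U = j`, in terms of `pⱼₖ = P(U = j, X = k)`. -/
noncomputable def d0 (q e : ℝ) (p : Fin 3 × Fin 2 → ℝ) (j : Fin 3) : ℝ :=
  if 1 / 2 ≤ q * (1 - e) * p (j, 0) / ((1 - e) * p (j, 0) + (1 - q) * e * p (j, 1)) then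
    1 - q * (1 - e) * p (j, 0) / ((1 - e) * p (j, 0) + (1 - q) * e * p (j, 1))
  else q * (1 - e) * p (j, 0) / ((1 - e) * p (j, 0) + (1 - q) * e * p (j, 1))

/-- The MAP error `d₁ⱼ` given `Z = 1`, `U = j`, in terms of `pⱼₖ = P(U = j, X = k)`. -/
noncomputable def d1 (q e : ℝ) (p : Fin 3 × Fin 2 → ℝ) (j : Fin 3) : ℝ :=
  if 1 / 2 ≤ q * e * p (j, 0) / (e * p (j, 0) + (1 - q) * (1 - e) * p (j, 1)) then
    1 - q * e * p (j, 0) / (e * p (j, 0) + (1 - q) * (1 - e) * p (j, 1))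
  else q * e * p (j, 0) / (e * p (j, 0) + (1 - q) * (1 - e) * p (j, 1))

/-- `∑_{i=0}^{1} ∑_{j=0}^{2} P(Z = i, U = j) dᵢⱼ`, where `L` is the joint law. -/
noncomputable def exampleDistortion (q a e : ℝ) (p : Fin 3 × Fin 2 → ℝ)
    (L : Letters (Fin 3) (Fin 2) (Fin 2) (Fin 2) ↥(sensingAlphabet a) → ℝ) : ℝ :=
  (∑ j, prob L (fun ω => Subtype.val (rvZ ω) = 0 ∧ rvU ω = j) * d0 q e p j) +
    ∑ j, prob L (fun ω => Subtype.val (rvZ ω) = 1 ∧ rvU ω = j) * d1 q e p j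

end ISAC

/-! The region claims are superposition coding with partial decoding. Cloud words are drawn i.i.d.
from `P_U`, and around each of them satellite words are drawn from `P_{X|U}`. The sensing receiver
decodes only the cloud word and applies the one-shot estimator `g` letter by letter to that word and
`Z`; the communication receiver treats `(S, Y)` as its output and decodes both words.

Decoding uses likelihood-ratio tests instead of typical sets. A test with threshold `γ` is passed by
an independent wrong word with probability at most `1 / γ` (change of measure, `mul_ind_le`). With
`γ = 2 ^ (n (I - δ))` the true word fails with vanishing probability, by the weak law for the
log-likelihood ratio (`tendsto_ratio_tail`), whose mean `I` is an information quantity. A wrong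
cloud at the sensing receiver costs `I(U;Z)`, a wrong satellite in the right cloud `I(X;Y|U,S)`, and
a word of a wrong cloud `I(X;Y|S)`; these are the three rate constraints.

One codebook must be good for both error and distortion, so the random-coding average is taken of `l
* confusion + cost` (`Ensemble.exists_codebook`). Letting `l` grow slowly with `n` makes the error
vanish without spoiling the distortion (`exists_sequence_of_tradeoff`). Non-strict rate inequalities
follow by shrinking the rates slightly (`mem_region_of_le`).

For the binary channel, `Y` is `X` when `S = 1` and constant when `S = 0`, so `I(X;Y|S)` is `q`
times the entropy of `X`. The optimal estimator errs with the smaller of the two joint masses of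
state and observation, and this vanishes at `Z = a` and `Z = a + 1`, which reveal `S = 1`. The
sum-rate point exists because all information quantities are nonnegative (Gibbs' inequality). -/

namespace ISAC

/-! ### Sums over product spaces and marginals of product laws -/

section ProductSums

variable {ι α β : Type*} [Fintype ι] [DecidableEq ι] [Fintype α] [Fintype β]

theorem sum_arrow_prod {M : Type*} [AddCommMonoid M] (F : (ι → α × β) → M) :
    ∑ f, F f = ∑ g : ι → α, ∑ h : ι → β, F fun i => (g i, h i) := by
  rw [← Fintype.sum_prod_type' (fun (g : ι → α) (h : ι → β) => F fun i => (g i, h i))]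
  exact Fintype.sum_equiv (Equiv.arrowProdEquivProdArrow ι (fun _ => α) (fun _ => β)) _ _ fun f => rfl

theorem sum_prod_pi (w : ι → α → ℝ) : ∑ c : ι → α, ∏ i, w i (c i) = ∏ i, ∑ a, w i a := by
  classical
  rw [Finset.prod_univ_sum, Fintype.piFinset_univ]

/-- The one-coordinate marginal of a product mass function. -/
theorem sum_pi_eval {w : ι → α → ℝ} (hw : ∀ i, ∑ a, w i a = 1) (i : ι) (f : α → ℝ) :
    ∑ c : ι → α, (∏ j, w j (c j)) * f (c i) = ∑ a, w i a * f a := by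
  -- Writing `f (c i)` as a product over all coordinates lets the whole sum factorize.
  have h : ∀ c : ι → α, (∏ j, w j (c j)) * f (c i) =
      ∏ j, (w j (c j) * if j = i then f (c j) else 1) := by
    intro c
    rw [Finset.prod_mul_distrib, Finset.prod_ite_eq' Finset.univ i]
    simp
  simp_rw [h]
  rw [sum_prod_pi (fun j a => w j a * if j = i then f a else 1),
    Finset.prod_eq_single i]
  · simp
  · intro j _ hj
    simp [hj, hw]
  · simp

theorem sum_pi_eval_mul {w : ι → α → ℝ} (hw : ∀ i, ∑ a, w i a = 1) {i j : ι} (hij : i ≠ j)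
    (f g : α → ℝ) :
    ∑ c : ι → α, (∏ k, w k (c k)) * (f (c i) * g (c j)) =
      (∑ a, w i a * f a) * ∑ b, w j b * g b := by
  have h : ∀ c : ι → α, (∏ k, w k (c k)) * (f (c i) * g (c j)) =
      ∏ k, (w k (c k) * ((if k = i then f (c k) else 1) * if k = j then g (c k) else 1)) := by
    intro c
    rw [Finset.prod_mul_distrib, Finset.prod_mul_distrib, Finset.prod_ite_eq' Finset.univ i,
      Finset.prod_ite_eq' Finset.univ j]
    simp
  simp_rw [h]
  rw [sum_prod_pi (fun k a => w k a * ((if k = i then f a else 1) * if k = j then g a else 1)),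
    Finset.prod_eq_mul i j hij]
  · simp [hij, hij.symm]
  · intro k _ hk
    simp [hk.1, hk.2, hw]
  · simp
  · simp

/-- The two-coordinate marginal of a product mass function. -/
theorem sum_pi_eval₂ {w : ι → α → ℝ} (hw : ∀ i, ∑ a, w i a = 1) {i j : ι} (hij : i ≠ j)
    (f : α → α → ℝ) :
    ∑ c : ι → α, (∏ k, w k (c k)) * f (c i) (c j) = ∑ a, ∑ b, w i a * w j b * f a b := by
  classical
  -- Splitting by the value of `c i` turns `f` into a sum of products of one-coordinate functions.
  have h : ∀ c : ι → α, (∏ k, w k (c k)) * f (c i) (c j) =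
      ∑ a, (∏ k, w k (c k)) * ((if c i = a then 1 else 0) * f a (c j)) := by
    intro c
    simp
  simp_rw [h]
  rw [Finset.sum_comm]
  refine Finset.sum_congr rfl fun a _ => ?_
  rw [sum_pi_eval_mul hw hij (fun a' => if a' = a then 1 else 0) (f a)]
  simp [Finset.mul_sum, mul_assoc]

theorem sum_pi_eq_one {w : ι → α → ℝ} (hw : ∀ i, ∑ a, w i a = 1) :
    ∑ c : ι → α, ∏ i, w i (c i) = 1 := by
  rw [sum_prod_pi]
  simp [hw]

/-- A mass function gives weight at least the average to some point whose value is at most the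
mean. -/
theorem exists_le_weighted_sum {w F : α → ℝ} (h0 : ∀ a, 0 ≤ w a) (h1 : ∑ a, w a = 1) :
    ∃ a, F a ≤ ∑ a, w a * F a := by
  by_contra! h
  set m := ∑ a, w a * F a with hm
  -- If every value exceeded the mean, this sum of nonnegative terms would force all weights to
  -- vanish.
  have : ∑ a, w a * (F a - m) = 0 := by
    simp_rw [mul_sub]
    rw [Finset.sum_sub_distrib, ← Finset.sum_mul, h1, ← hm]
    ring
  rw [Finset.sum_eq_zero_iff_of_nonneg
    (fun a _ => mul_nonneg (h0 a) (sub_nonneg.2 (h a).le))] at this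
  have hz : ∀ a, w a = 0 := fun a =>
    (mul_eq_zero.1 (this a (Finset.mem_univ a))).resolve_right (sub_pos.2 (h a)).ne'
  simp [hz] at h1

end ProductSums

/-! ### Chebyshev's inequality and the weak law for likelihood ratios -/

section LawOfLargeNumbers

open Classical in
/-- The indicator of a proposition. -/
noncomputable def ind (A : Prop) : ℝ := if A then 1 else 0

theorem ind_nonneg (A : Prop) : 0 ≤ ind A := by
  unfold ind; split_ifs <;> norm_num

theorem ind_le_one (A : Prop) : ind A ≤ 1 := by
  unfold ind; split_ifs <;> norm_num

theorem ind_of {A : Prop} (h : A) : ind A = 1 := if_pos h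

theorem ind_of_not {A : Prop} (h : ¬A) : ind A = 0 := if_neg h

variable {Ω : Type*} [Fintype Ω]

/-- Chebyshev's inequality for the lower tail of a sum of independent copies of `f`. -/
theorem lower_tail_le {P : Ω → ℝ} (hP : P ∈ stdSimplex ℝ Ω) (f : Ω → ℝ) {δ : ℝ} (hδ : 0 < δ)
    {n : ℕ} (hn : 0 < n) :
    ∑ ω : Fin n → Ω, (∏ i, P (ω i)) * ind (∑ i, f (ω i) < n * (expect P f - δ)) ≤
      (∑ x, P x * (f x - expect P f) ^ 2) / δ ^ 2 * (1 / n) := by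
  set m := expect P f with hm
  set v := ∑ x, P x * (f x - m) ^ 2 with hv
  have hn' : (0 : ℝ) < n := by exact_mod_cast hn
  have hw : ∀ _ : Fin n, ∑ x, P x = 1 := fun _ => hP.2
  have hmean : ∑ x, P x * (f x - m) = 0 := by
    simp_rw [mul_sub]
    rw [Finset.sum_sub_distrib, ← Finset.sum_mul, hP.2, hm, expect]
    ring
  have hsq : ∑ ω : Fin n → Ω, (∏ i, P (ω i)) * (∑ i, (f (ω i) - m)) ^ 2 = n * v := by
    have : ∀ ω : Fin n → Ω, (∏ i, P (ω i)) * (∑ i, (f (ω i) - m)) ^ 2 =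
        ∑ i, ∑ j, (∏ k, P (ω k)) * ((f (ω i) - m) * (f (ω j) - m)) := by
      intro ω
      rw [sq, Finset.sum_mul_sum, Finset.mul_sum]
      simp_rw [Finset.mul_sum]
    simp_rw [this]
    rw [Finset.sum_comm]
    have : ∀ i : Fin n, ∑ ω : Fin n → Ω, ∑ j, (∏ k, P (ω k)) * ((f (ω i) - m) * (f (ω j) - m)) =
        v := by
      intro i
      rw [Finset.sum_comm, Finset.sum_eq_single i]
      · rw [sum_pi_eval (w := fun _ => P) hw i (fun x => (f x - m) * (f x - m))]
        simp [hv, sq]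
      · intro j _ hj
        rw [sum_pi_eval_mul (w := fun _ => P) hw hj.symm (fun x => f x - m) (fun x => f x - m),
          hmean, zero_mul]
      · simp
    simp [this]
  -- On the tail event the centred sum lies below `-n δ`, so its square over `(n δ) ^ 2` is at least
  -- one.
  have key : ∀ ω : Fin n → Ω, (∏ i, P (ω i)) * ind (∑ i, f (ω i) < n * (m - δ)) ≤
      (∏ i, P (ω i)) * (∑ i, (f (ω i) - m)) ^ 2 / (n * δ) ^ 2 := by
    intro ω
    rw [mul_div_assoc]
    refine mul_le_mul_of_nonneg_left ?_ (Finset.prod_nonneg fun i _ => hP.1 _)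
    by_cases h : ∑ i, f (ω i) < n * (m - δ)
    · rw [ind_of h, one_le_div (by positivity)]
      have h2 : ∑ i, (f (ω i) - m) = ∑ i, f (ω i) - n * m := by simp
      have h3 : 0 < n * δ := by positivity
      rw [h2]
      nlinarith
    · rw [ind_of_not h]
      positivity
  refine (Finset.sum_le_sum fun ω _ => key ω).trans ?_
  rw [← Finset.sum_div, hsq]
  apply le_of_eq
  field_simp

/-- The weak law of large numbers for likelihood ratios: under `P`, a product of ratios
`num / den` exceeds every exponential whose rate is below the mean log-ratio. -/
theorem tendsto_ratio_tail {P num den : Ω → ℝ} (hP : P ∈ stdSimplex ℝ Ω)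
    (hnum : ∀ x, 0 < P x → 0 < num x) (hden : ∀ x, 0 < P x → 0 < den x) {I δ : ℝ}
    (hI : expect P (fun x => Real.logb 2 (num x / den x)) = I) (hδ : 0 < δ) :
    Filter.Tendsto (fun n : ℕ => ∑ ω : Fin n → Ω, (∏ i, P (ω i)) *
      ind (¬ (2 : ℝ) ^ ((n : ℝ) * (I - δ)) * ∏ i, den (ω i) ≤ ∏ i, num (ω i)))
      Filter.atTop (nhds 0) := by
  set f : Ω → ℝ := fun x => Real.logb 2 (num x / den x) with hf
  have hlim : Filter.Tendsto (fun n : ℕ => (∑ x, P x * (f x - expect P f) ^ 2) / δ ^ 2 *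
      (1 / (n : ℝ))) Filter.atTop (nhds 0) := by
    simpa using tendsto_one_div_atTop_nhds_zero_nat.const_mul
      ((∑ x, P x * (f x - expect P f) ^ 2) / δ ^ 2)
  refine squeeze_zero' (Filter.Eventually.of_forall fun n => Finset.sum_nonneg fun ω _ =>
    mul_nonneg (Finset.prod_nonneg fun i _ => hP.1 _) (ind_nonneg _)) ?_ hlim
  filter_upwards [Filter.eventually_gt_atTop 0] with n hn
  refine le_trans (Finset.sum_le_sum fun ω _ => ?_) (lower_tail_le hP f hδ hn)
  -- Logarithms are taken only on strings of positive probability, where all factors are positive;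
  -- the other strings have weight zero.
  by_cases hpos : ∀ i, 0 < P (ω i)
  · refine mul_le_mul_of_nonneg_left ?_ (Finset.prod_nonneg fun i _ => hP.1 _)
    by_cases h : ∑ i, f (ω i) < n * (expect P f - δ)
    · rw [ind_of h]
      exact ind_le_one _
    · rw [ind_of_not h, ind_of_not]
      rw [not_not]
      have hd : 0 < ∏ i, den (ω i) := Finset.prod_pos fun i _ => hden _ (hpos i)
      have hm : 0 < ∏ i, num (ω i) := Finset.prod_pos fun i _ => hnum _ (hpos i)
      rw [← le_div_iff₀ hd, ← Real.le_logb_iff_rpow_le (by norm_num) (by positivity),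
        ← Finset.prod_div_distrib, Real.logb_prod]
      · rw [hI] at h
        exact not_lt.1 h
      · exact fun i _ => (div_pos (hnum _ (hpos i)) (hden _ (hpos i))).ne'
  · push Not at hpos
    obtain ⟨i, hi⟩ := hpos
    have : ∏ i, P (ω i) = 0 := Finset.prod_eq_zero (Finset.mem_univ i) (le_antisymm hi (hP.1 _))
    simp [this]

end LawOfLargeNumbers

end ISAC

/-! ### One-shot superposition coding with likelihood-ratio tests -/

namespace ISAC

/-- A one-shot superposition ensemble: cloud centers `a ∼ PA`, satellites `b ∼ K a`, and a
two-receiver channel `V` from `b` to the pair `(t, z)`. -/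
structure Ensemble (A B T Z : Type*) [Fintype A] [Fintype B] [Fintype T] [Fintype Z] where
  PA : A → ℝ
  PA_mem : PA ∈ stdSimplex ℝ A
  K : A → B → ℝ
  K_mem : ∀ a, K a ∈ stdSimplex ℝ B
  V : B → T → Z → ℝ
  V_nonneg : ∀ b t z, 0 ≤ V b t z
  V_sum : ∀ b, ∑ t, ∑ z, V b t z = 1

namespace Ensemble

variable {A B T Z : Type*} [Fintype A] [Fintype B] [Fintype T] [Fintype Z]
  (E : Ensemble A B T Z)

/-- The expectation of `G` when one cloud center and one satellite are drawn and sent. -/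
noncomputable def mean (G : A → B → T → Z → ℝ) : ℝ :=
  ∑ a, ∑ b, ∑ t, ∑ z, E.PA a * E.K a b * E.V b t z * G a b t z

/-- The channel from `b` to `t`. -/
noncomputable def V₁ (b : B) (t : T) : ℝ := ∑ z, E.V b t z

/-- The channel from `b` to `z`. -/
noncomputable def V₂ (b : B) (z : Z) : ℝ := ∑ t, E.V b t z

/-- The channel from the cloud center to `t`. -/
noncomputable def cloud₁ (a : A) (t : T) : ℝ := ∑ b, E.K a b * E.V₁ b t

/-- The channel from the cloud center to `z`. -/
noncomputable def cloud₂ (a : A) (z : Z) : ℝ := ∑ b, E.K a b * E.V₂ b z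

/-- The output law of `t`. -/
noncomputable def out₁ (t : T) : ℝ := ∑ a, E.PA a * E.cloud₁ a t

/-- The output law of `z`. -/
noncomputable def out₂ (z : Z) : ℝ := ∑ a, E.PA a * E.cloud₂ a z

/-- The likelihood-ratio test of the second receiver for the cloud center. -/
def CloudTest (γ : ℝ) (a : A) (z : Z) : Prop := γ * E.out₂ z ≤ E.cloud₂ a z

/-- The likelihood-ratio test of the first receiver for the satellite given the cloud center. -/
def SatelliteTest (γ : ℝ) (a : A) (b : B) (t : T) : Prop := γ * E.cloud₁ a t ≤ E.V₁ b t

/-- The likelihood-ratio test of the first receiver for the codeword. -/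
def WordTest (γ : ℝ) (b : B) (t : T) : Prop := γ * E.out₁ t ≤ E.V₁ b t

theorem V₁_nonneg (b : B) (t : T) : 0 ≤ E.V₁ b t := Finset.sum_nonneg fun _ _ => E.V_nonneg _ _ _

theorem V₂_nonneg (b : B) (z : Z) : 0 ≤ E.V₂ b z := Finset.sum_nonneg fun _ _ => E.V_nonneg _ _ _

theorem V₁_sum (b : B) : ∑ t, E.V₁ b t = 1 := E.V_sum b

theorem V₂_sum (b : B) : ∑ z, E.V₂ b z = 1 := by
  unfold V₂; rw [Finset.sum_comm]; exact E.V_sum b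

theorem cloud₁_nonneg (a : A) (t : T) : 0 ≤ E.cloud₁ a t :=
  Finset.sum_nonneg fun _ _ => mul_nonneg ((E.K_mem a).1 _) (E.V₁_nonneg _ _)

theorem cloud₂_nonneg (a : A) (z : Z) : 0 ≤ E.cloud₂ a z :=
  Finset.sum_nonneg fun _ _ => mul_nonneg ((E.K_mem a).1 _) (E.V₂_nonneg _ _)

theorem cloud₂_sum (a : A) : ∑ z, E.cloud₂ a z = 1 := by
  unfold cloud₂
  rw [Finset.sum_comm]
  simp [← Finset.mul_sum, E.V₂_sum, (E.K_mem a).2]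

/-- Change of measure: where the test passes, the reference mass `x` is at most `y / γ`. Summing
over outputs, where `y` has total mass one, bounds every collision probability by `1 / γ`. -/
theorem mul_ind_le {γ x y : ℝ} (hγ : 0 < γ) (hy : 0 ≤ y) : x * ind (γ * x ≤ y) ≤ y / γ := by
  by_cases h : γ * x ≤ y
  · rw [ind_of h, mul_one, le_div_iff₀ hγ]
    linarith
  · rw [ind_of_not h, mul_zero]
    positivity

/-- The probability that an independent cloud center passes the cloud test. -/
theorem cloud_collision {γ : ℝ} (hγ : 0 < γ) :
    ∑ a, E.PA a * ∑ b, E.K a b * ∑ a', E.PA a' * ∑ t, ∑ z, E.V b t z * ind (E.CloudTest γ a' z) ≤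
      1 / γ := by
  -- The competitor `a'` is independent of the transmission, so averaging over the sent pair leaves
  -- `z` with the law `out₂`.
  have h : ∑ a, E.PA a * ∑ b, E.K a b * ∑ a', E.PA a' * ∑ t, ∑ z, E.V b t z *
      ind (E.CloudTest γ a' z) = ∑ a', E.PA a' * ∑ z, E.out₂ z * ind (E.CloudTest γ a' z) := by
    simp only [out₂, cloud₂, V₂, Finset.mul_sum, Finset.sum_mul]
    rw [Finset.sum_congr rfl fun a _ => Finset.sum_comm, Finset.sum_comm]
    refine Finset.sum_congr rfl fun a' _ => ?_
    rw [Finset.sum_comm' (t' := Finset.univ) (s' := fun _ => Finset.univ) (by simp)]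
    simp only [Finset.sum_comm (s := (Finset.univ : Finset Z))]
    rw [Finset.sum_comm]
    refine Finset.sum_congr rfl fun a _ => Finset.sum_congr rfl fun b _ =>
      Finset.sum_congr rfl fun t _ => Finset.sum_congr rfl fun z _ => by ring
  rw [h]
  calc _ ≤ ∑ a', E.PA a' * ∑ z, E.cloud₂ a' z / γ :=
        Finset.sum_le_sum fun a' _ => mul_le_mul_of_nonneg_left
          (Finset.sum_le_sum fun z _ => mul_ind_le hγ (E.cloud₂_nonneg a' z)) (E.PA_mem.1 a')
    _ = 1 / γ := by simp [← Finset.sum_div, E.cloud₂_sum, ← Finset.sum_mul, E.PA_mem.2]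

/-- The probability that an independent satellite of the same cloud passes the satellite test. -/
theorem satellite_collision {γ : ℝ} (hγ : 0 < γ) :
    ∑ a, E.PA a * ∑ b, ∑ b', E.K a b * E.K a b' * ∑ t, ∑ z, E.V b t z *
      ind (E.SatelliteTest γ a b' t) ≤ 1 / γ := by
  -- Sent and competing satellites share the cloud center and are independent only given `a`; hence
  -- the reference law of `t` is `cloud₁ a`.
  have h : ∀ a, ∑ b, ∑ b', E.K a b * E.K a b' * ∑ t, ∑ z, E.V b t z *
      ind (E.SatelliteTest γ a b' t) =
      ∑ b', E.K a b' * ∑ t, E.cloud₁ a t * ind (E.SatelliteTest γ a b' t) := by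
    intro a
    rw [Finset.sum_comm]
    refine Finset.sum_congr rfl fun b' _ => ?_
    simp only [cloud₁, V₁, Finset.mul_sum, Finset.sum_mul]
    rw [Finset.sum_comm]
    refine Finset.sum_congr rfl fun b _ =>
      Finset.sum_congr rfl fun t _ => Finset.sum_congr rfl fun z _ => by ring
  calc _ ≤ ∑ a, E.PA a * ∑ b', E.K a b' * ∑ t, E.V₁ b' t / γ := by
        simp_rw [h]
        exact Finset.sum_le_sum fun a _ => mul_le_mul_of_nonneg_left
          (Finset.sum_le_sum fun b _ => mul_le_mul_of_nonneg_left
            (Finset.sum_le_sum fun t _ => mul_ind_le hγ (E.V₁_nonneg b t)) ((E.K_mem a).1 b))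
          (E.PA_mem.1 a)
    _ = 1 / γ := by
        simp [← Finset.sum_div, E.V₁_sum, ← Finset.sum_mul, E.PA_mem.2, (E.K_mem _).2]

/-- The probability that an independent codeword passes the word test. -/
theorem word_collision {γ : ℝ} (hγ : 0 < γ) :
    ∑ a, E.PA a * ∑ b, E.K a b * ∑ a', E.PA a' * ∑ b', E.K a' b' * ∑ t, ∑ z, E.V b t z *
      ind (E.WordTest γ b' t) ≤ 1 / γ := by
  have h : ∑ a, E.PA a * ∑ b, E.K a b * ∑ a', E.PA a' * ∑ b', E.K a' b' * ∑ t, ∑ z, E.V b t z *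
      ind (E.WordTest γ b' t) =
      ∑ a', E.PA a' * ∑ b', E.K a' b' * ∑ t, E.out₁ t * ind (E.WordTest γ b' t) := by
    simp only [out₁, cloud₁, V₁, Finset.mul_sum, Finset.sum_mul]
    rw [Finset.sum_congr rfl fun a _ => Finset.sum_comm, Finset.sum_comm]
    refine Finset.sum_congr rfl fun a' _ => ?_
    rw [Finset.sum_congr rfl fun a _ => Finset.sum_comm, Finset.sum_comm]
    refine Finset.sum_congr rfl fun b' _ => ?_
    simp only [Finset.sum_comm (s := (Finset.univ : Finset T))]
    refine Finset.sum_congr rfl fun t _ => Finset.sum_congr rfl fun a _ =>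
      Finset.sum_congr rfl fun b _ => Finset.sum_congr rfl fun z _ => by ring
  rw [h]
  calc _ ≤ ∑ a, E.PA a * ∑ b', E.K a b' * ∑ t, E.V₁ b' t / γ :=
        Finset.sum_le_sum fun a _ => mul_le_mul_of_nonneg_left
          (Finset.sum_le_sum fun b _ => mul_le_mul_of_nonneg_left
            (Finset.sum_le_sum fun t _ => mul_ind_le hγ (E.V₁_nonneg b t)) ((E.K_mem a).1 b))
          (E.PA_mem.1 a)
    _ = 1 / γ := by
        simp [← Finset.sum_div, E.V₁_sum, ← Finset.sum_mul, E.PA_mem.2, (E.K_mem _).2]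

/-- The law of a cloud center together with its satellites. -/
noncomputable def row (M : ℕ) (x : A × (Fin M → B)) : ℝ := E.PA x.1 * ∏ w, E.K x.1 (x.2 w)

theorem row_mean {M : ℕ} (w : Fin M) (g : A → B → ℝ) :
    ∑ x, E.row M x * g x.1 (x.2 w) = ∑ a, E.PA a * ∑ b, E.K a b * g a b := by
  rw [Fintype.sum_prod_type]
  refine Finset.sum_congr rfl fun a _ => ?_
  rw [← sum_pi_eval (w := fun _ : Fin M => E.K a) (fun _ => (E.K_mem a).2) w (g a),
    Finset.mul_sum]
  exact Finset.sum_congr rfl fun x _ => by simp [row, mul_assoc]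

theorem row_mean₂ {M : ℕ} {w w' : Fin M} (hw : w ≠ w') (g : A → B → B → ℝ) :
    ∑ x, E.row M x * g x.1 (x.2 w) (x.2 w') =
      ∑ a, E.PA a * ∑ b, ∑ b', E.K a b * E.K a b' * g a b b' := by
  rw [Fintype.sum_prod_type]
  refine Finset.sum_congr rfl fun a _ => ?_
  rw [← sum_pi_eval₂ (w := fun _ : Fin M => E.K a) (fun _ => (E.K_mem a).2) hw (g a),
    Finset.mul_sum]
  exact Finset.sum_congr rfl fun x _ => by simp [row, mul_assoc]

theorem row_mem (M : ℕ) : E.row M ∈ stdSimplex ℝ (A × (Fin M → B)) := by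
  refine ⟨fun x => mul_nonneg (E.PA_mem.1 _)
    (Finset.prod_nonneg fun w _ => (E.K_mem _).1 _), ?_⟩
  rw [Fintype.sum_prod_type]
  have : ∀ a, ∑ b : Fin M → B, E.row M (a, b) = E.PA a := by
    intro a
    simp only [row]
    rw [← Finset.mul_sum, sum_pi_eq_one (w := fun _ => E.K a) fun _ => (E.K_mem a).2, mul_one]
  simp [this, E.PA_mem.2]

/-- The number of ways in which a message pair is confused by one of the tests, either because the
transmitted codeword fails a test or because another one passes it. -/
noncomputable def confusion {M₀ M₁ : ℕ} (γ₀ γ₁ γ₂ : ℝ) (c : Fin M₀ → A × (Fin M₁ → B))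
    (w₀ : Fin M₀) (w₁ : Fin M₁) (t : T) (z : Z) : ℝ :=
  ind (¬E.CloudTest γ₀ (c w₀).1 z) + ind (¬E.SatelliteTest γ₁ (c w₀).1 ((c w₀).2 w₁) t) +
    ind (¬E.WordTest γ₂ ((c w₀).2 w₁) t) +
    ∑ w₀' ∈ Finset.univ.erase w₀, ind (E.CloudTest γ₀ (c w₀').1 z) +
    ∑ w₁' ∈ Finset.univ.erase w₁, ind (E.SatelliteTest γ₁ (c w₀).1 ((c w₀).2 w₁') t) +
    ∑ w₀' ∈ Finset.univ.erase w₀, ∑ w₁', ind (E.WordTest γ₂ ((c w₀').2 w₁') t)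

/-- The mean of the confusion count and of the cost, over the random codebook and the channel, for
a fixed message pair. -/
theorem codebook_mean_le {M₀ M₁ : ℕ} {γ₀ γ₁ γ₂ : ℝ} (h₀ : 0 < γ₀) (h₁ : 0 < γ₁) (h₂ : 0 < γ₂)
    {l : ℝ} (hl : 0 ≤ l) (cost : A → T → Z → ℝ) (w₀ : Fin M₀) (w₁ : Fin M₁) :
    ∑ c : Fin M₀ → A × (Fin M₁ → B), (∏ w, E.row M₁ (c w)) *
        ∑ t, ∑ z, E.V ((c w₀).2 w₁) t z *
          (l * E.confusion γ₀ γ₁ γ₂ c w₀ w₁ t z + cost (c w₀).1 t z) ≤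
      l * (E.mean (fun a _ _ z => ind (¬E.CloudTest γ₀ a z)) +
        E.mean (fun a b t _ => ind (¬E.SatelliteTest γ₁ a b t)) +
        E.mean (fun _ b t _ => ind (¬E.WordTest γ₂ b t)) +
        ((M₀ : ℝ) - 1) / γ₀ + ((M₁ : ℝ) - 1) / γ₁ + ((M₀ : ℝ) - 1) * M₁ / γ₂) +
      E.mean (fun a _ t z => cost a t z) := by
  have hrow : ∀ _ : Fin M₀, ∑ x, E.row M₁ x = 1 := fun _ => (E.row_mem M₁).2
  -- The exact count of wrong messages is kept: it is zero for a single message, which later exempts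
  -- zero rates from strict inequalities.
  have hM₀ : ((Finset.univ.erase w₀).card : ℝ) = (M₀ : ℝ) - 1 := by
    rw [Finset.card_erase_of_mem (Finset.mem_univ _), Finset.card_univ, Fintype.card_fin,
      Nat.cast_sub (by have := w₀.pos; omega), Nat.cast_one]
  have hM₁ : ((Finset.univ.erase w₁).card : ℝ) = (M₁ : ℝ) - 1 := by
    rw [Finset.card_erase_of_mem (Finset.mem_univ _), Finset.card_univ, Fintype.card_fin,
      Nat.cast_sub (by have := w₁.pos; omega), Nat.cast_one]
  have own : ∀ G : A → B → T → Z → ℝ, ∑ c : Fin M₀ → A × (Fin M₁ → B), (∏ w, E.row M₁ (c w)) *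
      (∑ t, ∑ z, E.V ((c w₀).2 w₁) t z * G (c w₀).1 ((c w₀).2 w₁) t z) = E.mean G := by
    intro G
    rw [sum_pi_eval (w := fun _ => E.row M₁) hrow w₀
      (fun x => ∑ t, ∑ z, E.V (x.2 w₁) t z * G x.1 (x.2 w₁) t z),
      E.row_mean w₁ (fun a b => ∑ t, ∑ z, E.V b t z * G a b t z)]
    simp only [mean, Finset.mul_sum, mul_assoc]
  -- Distinct rows of the codebook are independent, so the two-coordinate marginal is a product.
  have cloud : ∀ w₀' ∈ Finset.univ.erase w₀, ∑ c : Fin M₀ → A × (Fin M₁ → B),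
      (∏ w, E.row M₁ (c w)) *
      (∑ t, ∑ z, E.V ((c w₀).2 w₁) t z * ind (E.CloudTest γ₀ (c w₀').1 z)) ≤ 1 / γ₀ := by
    intro w₀' hw
    rw [sum_pi_eval₂ (w := fun _ => E.row M₁) hrow (Finset.ne_of_mem_erase hw).symm
      (fun x x' => ∑ t, ∑ z, E.V (x.2 w₁) t z * ind (E.CloudTest γ₀ x'.1 z))]
    simp_rw [mul_assoc, ← Finset.mul_sum]
    rw [Finset.sum_congr rfl fun x _ => by rw [E.row_mean w₁ (fun a' _ => ∑ t, ∑ z,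
      E.V (x.2 w₁) t z * ind (E.CloudTest γ₀ a' z))],
      E.row_mean w₁ (fun _ b => ∑ a', E.PA a' * ∑ b', E.K a' b' * ∑ t, ∑ z, E.V b t z *
        ind (E.CloudTest γ₀ a' z))]
    simp_rw [← Finset.sum_mul, (E.K_mem _).2, one_mul]
    exact E.cloud_collision h₀
  have satellite : ∀ w₁' ∈ Finset.univ.erase w₁, ∑ c : Fin M₀ → A × (Fin M₁ → B),
      (∏ w, E.row M₁ (c w)) * (∑ t, ∑ z, E.V ((c w₀).2 w₁) t z *
        ind (E.SatelliteTest γ₁ (c w₀).1 ((c w₀).2 w₁') t)) ≤ 1 / γ₁ := by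
    intro w₁' hw
    rw [sum_pi_eval (w := fun _ => E.row M₁) hrow w₀ (fun x => ∑ t, ∑ z, E.V (x.2 w₁) t z *
        ind (E.SatelliteTest γ₁ x.1 (x.2 w₁') t)),
      E.row_mean₂ (Finset.ne_of_mem_erase hw).symm (fun a b b' => ∑ t, ∑ z, E.V b t z *
        ind (E.SatelliteTest γ₁ a b' t))]
    exact E.satellite_collision h₁
  have word : ∀ w₀' ∈ Finset.univ.erase w₀, ∀ w₁', ∑ c : Fin M₀ → A × (Fin M₁ → B),
      (∏ w, E.row M₁ (c w)) * (∑ t, ∑ z, E.V ((c w₀).2 w₁) t z *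
        ind (E.WordTest γ₂ ((c w₀').2 w₁') t)) ≤ 1 / γ₂ := by
    intro w₀' hw w₁'
    rw [sum_pi_eval₂ (w := fun _ => E.row M₁) hrow (Finset.ne_of_mem_erase hw).symm
      (fun x x' => ∑ t, ∑ z, E.V (x.2 w₁) t z * ind (E.WordTest γ₂ (x'.2 w₁') t))]
    simp_rw [mul_assoc, ← Finset.mul_sum]
    rw [Finset.sum_congr rfl fun x _ => by rw [E.row_mean w₁' (fun _ b' => ∑ t, ∑ z,
      E.V (x.2 w₁) t z * ind (E.WordTest γ₂ b' t))],
      E.row_mean w₁ (fun _ b => ∑ a', E.PA a' * ∑ b', E.K a' b' * ∑ t, ∑ z, E.V b t z *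
        ind (E.WordTest γ₂ b' t))]
    exact E.word_collision h₂
  have split : ∀ c : Fin M₀ → A × (Fin M₁ → B), (∏ w, E.row M₁ (c w)) *
        (∑ t, ∑ z, E.V ((c w₀).2 w₁) t z *
          (l * E.confusion γ₀ γ₁ γ₂ c w₀ w₁ t z + cost (c w₀).1 t z)) =
      l * ((∏ w, E.row M₁ (c w)) * (∑ t, ∑ z, E.V ((c w₀).2 w₁) t z *
          ind (¬E.CloudTest γ₀ (c w₀).1 z)) +
        (∏ w, E.row M₁ (c w)) * (∑ t, ∑ z, E.V ((c w₀).2 w₁) t z *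
          ind (¬E.SatelliteTest γ₁ (c w₀).1 ((c w₀).2 w₁) t)) +
        (∏ w, E.row M₁ (c w)) * (∑ t, ∑ z, E.V ((c w₀).2 w₁) t z *
          ind (¬E.WordTest γ₂ ((c w₀).2 w₁) t)) +
        ∑ w₀' ∈ Finset.univ.erase w₀, (∏ w, E.row M₁ (c w)) *
          (∑ t, ∑ z, E.V ((c w₀).2 w₁) t z * ind (E.CloudTest γ₀ (c w₀').1 z)) +
        ∑ w₁' ∈ Finset.univ.erase w₁, (∏ w, E.row M₁ (c w)) *
          (∑ t, ∑ z, E.V ((c w₀).2 w₁) t z *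
            ind (E.SatelliteTest γ₁ (c w₀).1 ((c w₀).2 w₁') t)) +
        ∑ w₀' ∈ Finset.univ.erase w₀, ∑ w₁', (∏ w, E.row M₁ (c w)) *
          (∑ t, ∑ z, E.V ((c w₀).2 w₁) t z * ind (E.WordTest γ₂ ((c w₀').2 w₁') t))) +
      (∏ w, E.row M₁ (c w)) * (∑ t, ∑ z, E.V ((c w₀).2 w₁) t z * cost (c w₀).1 t z) := by
    intro c
    simp only [confusion, mul_add, Finset.sum_add_distrib, Finset.mul_sum]
    have e : ∀ x y z w : ℝ, x * (y * (z * w)) = z * (x * (y * w)) := fun x y z w => by ring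
    simp only [e]
    congr 1
    congr 1
    · congr 1
      · congr 1
        rw [Finset.sum_congr rfl fun t _ => Finset.sum_comm, Finset.sum_comm]
      · rw [Finset.sum_congr rfl fun t _ => Finset.sum_comm, Finset.sum_comm]
    · rw [Finset.sum_congr rfl fun t _ => Finset.sum_comm, Finset.sum_comm]
      refine Finset.sum_congr rfl fun w₀' _ => ?_
      rw [Finset.sum_congr rfl fun t _ => Finset.sum_comm, Finset.sum_comm]
  simp_rw [split]
  rw [Finset.sum_add_distrib, ← Finset.mul_sum]
  simp only [Finset.sum_add_distrib]
  rw [own fun a _ _ z => ind (¬E.CloudTest γ₀ a z),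
    own fun a b t _ => ind (¬E.SatelliteTest γ₁ a b t),
    own fun _ b t _ => ind (¬E.WordTest γ₂ b t), own fun a _ t z => cost a t z]
  have i₀ : ∑ c : Fin M₀ → A × (Fin M₁ → B), ∑ w₀' ∈ Finset.univ.erase w₀,
      (∏ w, E.row M₁ (c w)) * (∑ t, ∑ z, E.V ((c w₀).2 w₁) t z *
        ind (E.CloudTest γ₀ (c w₀').1 z)) ≤ ((M₀ : ℝ) - 1) / γ₀ := by
    rw [Finset.sum_comm]
    refine (Finset.sum_le_card_nsmul _ _ _ cloud).trans_eq ?_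
    rw [nsmul_eq_mul, hM₀, mul_one_div]
  have i₁ : ∑ c : Fin M₀ → A × (Fin M₁ → B), ∑ w₁' ∈ Finset.univ.erase w₁,
      (∏ w, E.row M₁ (c w)) * (∑ t, ∑ z, E.V ((c w₀).2 w₁) t z *
        ind (E.SatelliteTest γ₁ (c w₀).1 ((c w₀).2 w₁') t)) ≤ ((M₁ : ℝ) - 1) / γ₁ := by
    rw [Finset.sum_comm]
    refine (Finset.sum_le_card_nsmul _ _ _ satellite).trans_eq ?_
    rw [nsmul_eq_mul, hM₁, mul_one_div]
  have i₂ : ∑ c : Fin M₀ → A × (Fin M₁ → B), ∑ w₀' ∈ Finset.univ.erase w₀, ∑ w₁',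
      (∏ w, E.row M₁ (c w)) * (∑ t, ∑ z, E.V ((c w₀).2 w₁) t z *
        ind (E.WordTest γ₂ ((c w₀').2 w₁') t)) ≤ ((M₀ : ℝ) - 1) * M₁ / γ₂ := by
    rw [Finset.sum_comm]
    refine (Finset.sum_le_card_nsmul _ _ (M₁ * (1 / γ₂)) fun w₀' hw => ?_).trans_eq ?_
    · rw [Finset.sum_comm]
      refine (Finset.sum_le_card_nsmul _ _ _ fun w₁' _ => word w₀' hw w₁').trans_eq ?_
      simp
    · rw [nsmul_eq_mul, hM₀]
      ring
  gcongr

/-- One-shot superposition coding: some codebook does as well as the random one. -/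
theorem exists_codebook {M₀ M₁ : ℕ} (hM₀ : 0 < M₀) (hM₁ : 0 < M₁) {γ₀ γ₁ γ₂ : ℝ}
    (h₀ : 0 < γ₀) (h₁ : 0 < γ₁) (h₂ : 0 < γ₂) {l : ℝ} (hl : 0 ≤ l) (cost : A → T → Z → ℝ) :
    ∃ c : Fin M₀ → A × (Fin M₁ → B),
      (1 / ((M₀ : ℝ) * M₁)) * ∑ w₀, ∑ w₁, ∑ t, ∑ z, E.V ((c w₀).2 w₁) t z *
          (l * E.confusion γ₀ γ₁ γ₂ c w₀ w₁ t z + cost (c w₀).1 t z) ≤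
      l * (E.mean (fun a _ _ z => ind (¬E.CloudTest γ₀ a z)) +
        E.mean (fun a b t _ => ind (¬E.SatelliteTest γ₁ a b t)) +
        E.mean (fun _ b t _ => ind (¬E.WordTest γ₂ b t)) +
        ((M₀ : ℝ) - 1) / γ₀ + ((M₁ : ℝ) - 1) / γ₁ + ((M₀ : ℝ) - 1) * M₁ / γ₂) +
      E.mean (fun a _ t z => cost a t z) := by
  -- Derandomization gives one codebook for one functional only, which is why confusion and cost are
  -- combined through `l`.
  obtain ⟨c, hc⟩ := exists_le_weighted_sum
    (w := fun c : Fin M₀ → A × (Fin M₁ → B) => ∏ w, E.row M₁ (c w))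
    (F := fun c => (1 / ((M₀ : ℝ) * M₁)) * ∑ w₀, ∑ w₁, ∑ t, ∑ z, E.V ((c w₀).2 w₁) t z *
          (l * E.confusion γ₀ γ₁ γ₂ c w₀ w₁ t z + cost (c w₀).1 t z))
    (fun c => Finset.prod_nonneg fun w _ => (E.row_mem M₁).1 _)
    (sum_pi_eq_one (w := fun _ => E.row M₁) fun _ => (E.row_mem M₁).2)
  refine ⟨c, hc.trans ?_⟩
  have hM : (0 : ℝ) < (M₀ : ℝ) * M₁ := by positivity
  simp_rw [mul_left_comm _ (1 / ((M₀ : ℝ) * M₁))]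
  rw [← Finset.mul_sum, one_div, inv_mul_le_iff₀ hM]
  simp_rw [Finset.mul_sum (s := (Finset.univ : Finset (Fin M₀)))]
  rw [Finset.sum_comm]
  simp_rw [Finset.mul_sum (s := (Finset.univ : Finset (Fin M₁)))]
  rw [Finset.sum_congr rfl fun w _ => Finset.sum_comm]
  refine (Finset.sum_le_card_nsmul _ _ _ fun w₀ _ => Finset.sum_le_card_nsmul _ _ _ fun w₁ _ =>
    E.codebook_mean_le h₀ h₁ h₂ hl cost w₀ w₁).trans_eq ?_
  simp only [Finset.card_univ, Fintype.card_fin, nsmul_eq_mul]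
  ring

end Ensemble

end ISAC

/-! ### Independent letters and the asymptotics of the tests -/

namespace ISAC

open Filter Topology

namespace Ensemble

variable {A B T Z : Type*} [Fintype A] [Fintype B] [Fintype T] [Fintype Z]
  (E : Ensemble A B T Z)

/-- The ensemble of `n` independent letters. -/
noncomputable def pow (n : ℕ) : Ensemble (Fin n → A) (Fin n → B) (Fin n → T) (Fin n → Z) where
  PA a := ∏ i, E.PA (a i)
  PA_mem := ⟨fun _ => Finset.prod_nonneg fun _ _ => E.PA_mem.1 _,
    sum_pi_eq_one (w := fun _ => E.PA) fun _ => E.PA_mem.2⟩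
  K a b := ∏ i, E.K (a i) (b i)
  K_mem a := ⟨fun _ => Finset.prod_nonneg fun _ _ => (E.K_mem _).1 _,
    sum_pi_eq_one (w := fun i => E.K (a i)) fun _ => (E.K_mem _).2⟩
  V b t z := ∏ i, E.V (b i) (t i) (z i)
  V_nonneg _ _ _ := Finset.prod_nonneg fun _ _ => E.V_nonneg _ _ _
  V_sum b := by
    rw [Finset.sum_congr rfl fun t _ => sum_prod_pi fun i z => E.V (b i) (t i) z,
      sum_prod_pi fun i t => ∑ z, E.V (b i) t z]
    simp [E.V_sum]

variable {n : ℕ}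

/-- Like this marginal, all laws entering the tests factorize over the letters, so an `n`-letter
test compares two products, as `tendsto_ratio_tail` requires. -/
theorem pow_V₁ (b : Fin n → B) (t : Fin n → T) :
    (E.pow n).V₁ b t = ∏ i, E.V₁ (b i) (t i) :=
  sum_prod_pi fun i z => E.V (b i) (t i) z

theorem pow_V₂ (b : Fin n → B) (z : Fin n → Z) :
    (E.pow n).V₂ b z = ∏ i, E.V₂ (b i) (z i) :=
  sum_prod_pi fun i t => E.V (b i) t (z i)

theorem pow_cloud₁ (a : Fin n → A) (t : Fin n → T) :
    (E.pow n).cloud₁ a t = ∏ i, E.cloud₁ (a i) (t i) := by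
  simp only [cloud₁, pow_V₁]
  rw [← sum_prod_pi fun i b => E.K (a i) b * E.V₁ b (t i)]
  simp only [pow, Finset.prod_mul_distrib]

theorem pow_cloud₂ (a : Fin n → A) (z : Fin n → Z) :
    (E.pow n).cloud₂ a z = ∏ i, E.cloud₂ (a i) (z i) := by
  simp only [cloud₂, pow_V₂]
  rw [← sum_prod_pi fun i b => E.K (a i) b * E.V₂ b (z i)]
  simp only [pow, Finset.prod_mul_distrib]

theorem pow_out₁ (t : Fin n → T) : (E.pow n).out₁ t = ∏ i, E.out₁ (t i) := by
  simp only [out₁, pow_cloud₁]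
  rw [← sum_prod_pi fun i a => E.PA a * E.cloud₁ a (t i)]
  simp only [pow, Finset.prod_mul_distrib]

theorem pow_out₂ (z : Fin n → Z) : (E.pow n).out₂ z = ∏ i, E.out₂ (z i) := by
  simp only [out₂, pow_cloud₂]
  rw [← sum_prod_pi fun i a => E.PA a * E.cloud₂ a (z i)]
  simp only [pow, Finset.prod_mul_distrib]

/-- The joint law of cloud center, satellite and outputs. -/
noncomputable def law (x : A × B × T × Z) : ℝ :=
  E.PA x.1 * E.K x.1 x.2.1 * E.V x.2.1 x.2.2.1 x.2.2.2

theorem law_nonneg (x : A × B × T × Z) : 0 ≤ E.law x :=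
  mul_nonneg (mul_nonneg (E.PA_mem.1 _) ((E.K_mem _).1 _)) (E.V_nonneg _ _ _)

theorem mean_eq_expect (G : A → B → T → Z → ℝ) :
    E.mean G = expect E.law fun x => G x.1 x.2.1 x.2.2.1 x.2.2.2 := by
  simp only [mean, expect, Fintype.sum_prod_type, law]

theorem law_mem : E.law ∈ stdSimplex ℝ (A × B × T × Z) := by
  refine ⟨E.law_nonneg, ?_⟩
  simp only [Fintype.sum_prod_type, law, ← Finset.mul_sum, E.V_sum, (E.K_mem _).2, E.PA_mem.2,
    mul_one]

theorem pow_mean (G : (Fin n → A) → (Fin n → B) → (Fin n → T) → (Fin n → Z) → ℝ) :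
    (E.pow n).mean G = ∑ ω : Fin n → A × B × T × Z, (∏ i, E.law (ω i)) *
      G (fun i => (ω i).1) (fun i => (ω i).2.1) (fun i => (ω i).2.2.1) fun i => (ω i).2.2.2 := by
  simp only [sum_arrow_prod, mean, law, pow, Finset.prod_mul_distrib]

/-- Likelihood ratios are controlled only on the support of the law; from this all numerators and
denominators are positive there. -/
theorem pos_of_law_pos {x : A × B × T × Z} (h : 0 < E.law x) :
    0 < E.PA x.1 ∧ 0 < E.K x.1 x.2.1 ∧ 0 < E.V x.2.1 x.2.2.1 x.2.2.2 := by
  refine ⟨(E.PA_mem.1 _).lt_of_ne' fun h0 => ?_, ((E.K_mem _).1 _).lt_of_ne' fun h0 => ?_,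
    (E.V_nonneg _ _ _).lt_of_ne' fun h0 => ?_⟩ <;> simp [law, h0] at h

theorem V₁_pos {x : A × B × T × Z} (h : 0 < E.law x) : 0 < E.V₁ x.2.1 x.2.2.1 :=
  (E.pos_of_law_pos h).2.2.trans_le
    (Finset.single_le_sum (f := fun z => E.V x.2.1 x.2.2.1 z) (fun _ _ => E.V_nonneg _ _ _)
      (Finset.mem_univ _))

theorem V₂_pos {x : A × B × T × Z} (h : 0 < E.law x) : 0 < E.V₂ x.2.1 x.2.2.2 :=
  (E.pos_of_law_pos h).2.2.trans_le
    (Finset.single_le_sum (f := fun t => E.V x.2.1 t x.2.2.2) (fun _ _ => E.V_nonneg _ _ _)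
      (Finset.mem_univ _))

theorem cloud₁_pos {x : A × B × T × Z} (h : 0 < E.law x) : 0 < E.cloud₁ x.1 x.2.2.1 :=
  (mul_pos (E.pos_of_law_pos h).2.1 (E.V₁_pos h)).trans_le
    (Finset.single_le_sum (f := fun b => E.K x.1 b * E.V₁ b x.2.2.1)
      (fun _ _ => mul_nonneg ((E.K_mem _).1 _) (E.V₁_nonneg _ _)) (Finset.mem_univ _))

theorem cloud₂_pos {x : A × B × T × Z} (h : 0 < E.law x) : 0 < E.cloud₂ x.1 x.2.2.2 :=
  (mul_pos (E.pos_of_law_pos h).2.1 (E.V₂_pos h)).trans_le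
    (Finset.single_le_sum (f := fun b => E.K x.1 b * E.V₂ b x.2.2.2)
      (fun _ _ => mul_nonneg ((E.K_mem _).1 _) (E.V₂_nonneg _ _)) (Finset.mem_univ _))

theorem out₁_pos {x : A × B × T × Z} (h : 0 < E.law x) : 0 < E.out₁ x.2.2.1 :=
  (mul_pos (E.pos_of_law_pos h).1 (E.cloud₁_pos h)).trans_le
    (Finset.single_le_sum (f := fun a => E.PA a * E.cloud₁ a x.2.2.1)
      (fun _ _ => mul_nonneg (E.PA_mem.1 _) (E.cloud₁_nonneg _ _)) (Finset.mem_univ _))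

theorem out₂_pos {x : A × B × T × Z} (h : 0 < E.law x) : 0 < E.out₂ x.2.2.2 :=
  (mul_pos (E.pos_of_law_pos h).1 (E.cloud₂_pos h)).trans_le
    (Finset.single_le_sum (f := fun a => E.PA a * E.cloud₂ a x.2.2.2)
      (fun _ _ => mul_nonneg (E.PA_mem.1 _) (E.cloud₂_nonneg _ _)) (Finset.mem_univ _))

/-- The mutual information, in bits, of the cloud center and `z`. -/
noncomputable def cloudInfo : ℝ :=
  expect E.law fun x => Real.logb 2 (E.cloud₂ x.1 x.2.2.2 / E.out₂ x.2.2.2)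

/-- The mutual information, in bits, of the satellite and `t` given the cloud center. -/
noncomputable def satelliteInfo : ℝ :=
  expect E.law fun x => Real.logb 2 (E.V₁ x.2.1 x.2.2.1 / E.cloud₁ x.1 x.2.2.1)

/-- The mutual information, in bits, of the satellite and `t`. -/
noncomputable def wordInfo : ℝ :=
  expect E.law fun x => Real.logb 2 (E.V₁ x.2.1 x.2.2.1 / E.out₁ x.2.2.1)

theorem tendsto_cloud_miss {δ : ℝ} (hδ : 0 < δ) :
    Tendsto (fun n : ℕ => (E.pow n).mean fun a _ _ z =>
      ind (¬(E.pow n).CloudTest ((2 : ℝ) ^ ((n : ℝ) * (E.cloudInfo - δ))) a z)) atTop (𝓝 0) := by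
  simp only [pow_mean, CloudTest, pow_out₂, pow_cloud₂]
  exact tendsto_ratio_tail (P := E.law) E.law_mem (num := fun x => E.cloud₂ x.1 x.2.2.2)
    (den := fun x => E.out₂ x.2.2.2) (fun x h => E.cloud₂_pos h) (fun x h => E.out₂_pos h)
    (I := E.cloudInfo) (by rw [cloudInfo]) hδ

theorem tendsto_satellite_miss {δ : ℝ} (hδ : 0 < δ) :
    Tendsto (fun n : ℕ => (E.pow n).mean fun a b t _ =>
      ind (¬(E.pow n).SatelliteTest ((2 : ℝ) ^ ((n : ℝ) * (E.satelliteInfo - δ))) a b t))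
      atTop (𝓝 0) := by
  simp only [pow_mean, SatelliteTest, pow_cloud₁, pow_V₁]
  exact tendsto_ratio_tail (P := E.law) E.law_mem (num := fun x => E.V₁ x.2.1 x.2.2.1)
    (den := fun x => E.cloud₁ x.1 x.2.2.1) (fun x h => E.V₁_pos h) (fun x h => E.cloud₁_pos h)
    (I := E.satelliteInfo) (by rw [satelliteInfo]) hδ

theorem tendsto_word_miss {δ : ℝ} (hδ : 0 < δ) :
    Tendsto (fun n : ℕ => (E.pow n).mean fun _ b t _ =>
      ind (¬(E.pow n).WordTest ((2 : ℝ) ^ ((n : ℝ) * (E.wordInfo - δ))) b t)) atTop (𝓝 0) := by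
  simp only [pow_mean, WordTest, pow_out₁, pow_V₁]
  exact tendsto_ratio_tail (P := E.law) E.law_mem (num := fun x => E.V₁ x.2.1 x.2.2.1)
    (den := fun x => E.out₁ x.2.2.1) (fun x h => E.V₁_pos h) (fun x h => E.out₁_pos h)
    (I := E.wordInfo) (by rw [wordInfo]) hδ

/-- Each letter contributes the same single-letter mean. Equality can fail only at `n = 0`, where `1
/ 0 = 0` makes the left side zero; nonnegativity of `κ` covers that case. -/
theorem pow_mean_average_le {κ : A → T → Z → ℝ} (hκ : ∀ a t z, 0 ≤ κ a t z) :
    (E.pow n).mean (fun a _ t z => (1 / (n : ℝ)) * ∑ i, κ (a i) (t i) (z i)) ≤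
      E.mean fun a _ t z => κ a t z := by
  have h0 : 0 ≤ E.mean fun a _ t z => κ a t z := by
    rw [mean_eq_expect]
    exact Finset.sum_nonneg fun x _ => mul_nonneg (E.law_nonneg x) (hκ _ _ _)
  rcases Nat.eq_zero_or_pos n with rfl | hn
  · simpa [mean] using h0
  · have hn' : (n : ℝ) ≠ 0 := by positivity
    rw [pow_mean]
    simp_rw [mul_left_comm _ (1 / (n : ℝ)), Finset.mul_sum]
    rw [Finset.sum_comm]
    simp_rw [← Finset.mul_sum]
    rw [Finset.sum_congr rfl fun i _ => sum_pi_eval (w := fun _ => E.law)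
      (fun _ => E.law_mem.2) i fun x => κ x.1 x.2.2.1 x.2.2.2, mean_eq_expect, expect]
    simp [hn']

end Ensemble

/-! ### Message counts against exponential thresholds -/

theorem ceil_sub_one_nonneg (n : ℕ) (R : ℝ) : 0 ≤ (⌈(2 : ℝ) ^ ((n : ℝ) * R)⌉₊ : ℝ) - 1 := by
  have : 0 < ⌈(2 : ℝ) ^ ((n : ℝ) * R)⌉₊ := Nat.ceil_pos.2 (by positivity)
  have : (1 : ℝ) ≤ (⌈(2 : ℝ) ^ ((n : ℝ) * R)⌉₊ : ℝ) := by exact_mod_cast this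
  linarith

theorem ceil_sub_one_le (n : ℕ) (R : ℝ) :
    (⌈(2 : ℝ) ^ ((n : ℝ) * R)⌉₊ : ℝ) - 1 ≤ (2 : ℝ) ^ ((n : ℝ) * R) := by
  have := Nat.ceil_lt_add_one (a := (2 : ℝ) ^ ((n : ℝ) * R)) (by positivity)
  linarith

theorem tendsto_two_rpow_neg {r : ℝ} (hr : r < 0) :
    Tendsto (fun n : ℕ => (2 : ℝ) ^ ((n : ℝ) * r)) atTop (𝓝 0) := by
  have : ∀ n : ℕ, (2 : ℝ) ^ ((n : ℝ) * r) = ((2 : ℝ) ^ r) ^ n := fun n => by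
    rw [mul_comm, Real.rpow_mul (by norm_num), Real.rpow_natCast]
  simp_rw [this]
  exact tendsto_pow_atTop_nhds_zero_of_lt_one (by positivity)
    (Real.rpow_lt_one_of_one_lt_of_neg (by norm_num) hr)

/-- The union bound over the other messages vanishes below the threshold rate. -/
theorem exists_margin {R I : ℝ} (h : R = 0 ∨ R < I) :
    ∃ δ : ℝ, 0 < δ ∧ Tendsto (fun n : ℕ => ((⌈(2 : ℝ) ^ ((n : ℝ) * R)⌉₊ : ℝ) - 1) /
      (2 : ℝ) ^ ((n : ℝ) * (I - δ))) atTop (𝓝 0) := by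
  rcases h with rfl | h
  -- At rate zero there is exactly one message, so the sequence is identically zero and any margin
  -- works.
  · exact ⟨1, one_pos, by simp⟩
  -- Half of the gap goes to the margin; the other half remains as the exponent `(R - I) / 2`.
  · refine ⟨(I - R) / 2, by linarith, squeeze_zero (fun n => div_nonneg (ceil_sub_one_nonneg n R)
      (by positivity)) (fun n => ?_) (tendsto_two_rpow_neg (r := (R - I) / 2) (by linarith))⟩
    rw [div_le_iff₀ (by positivity), ← Real.rpow_add (by norm_num)]
    refine (ceil_sub_one_le n R).trans_eq ?_
    congr 1
    ring

/-- The union bound over the other message pairs vanishes below the threshold sum rate. -/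
theorem exists_margin_pair {R₀ R₁ I : ℝ} (hR₁ : 0 ≤ R₁) (h : R₀ = 0 ∨ R₀ + R₁ < I) :
    ∃ δ : ℝ, 0 < δ ∧ Tendsto (fun n : ℕ => ((⌈(2 : ℝ) ^ ((n : ℝ) * R₀)⌉₊ : ℝ) - 1) *
      (⌈(2 : ℝ) ^ ((n : ℝ) * R₁)⌉₊ : ℝ) / (2 : ℝ) ^ ((n : ℝ) * (I - δ))) atTop (𝓝 0) := by
  rcases h with rfl | h
  · exact ⟨1, one_pos, by simp⟩
  · have hlim := (tendsto_two_rpow_neg (r := (R₀ + R₁ - I) / 2) (by linarith)).const_mul 2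
    rw [mul_zero] at hlim
    refine ⟨(I - (R₀ + R₁)) / 2, by linarith, squeeze_zero (fun n => div_nonneg
      (mul_nonneg (ceil_sub_one_nonneg n R₀) (by positivity)) (by positivity)) (fun n => ?_) hlim⟩
    -- All private messages of a wrong cloud compete, so no one is subtracted here; the factor 2
    -- absorbs the rounding.
    have h1 : (⌈(2 : ℝ) ^ ((n : ℝ) * R₁)⌉₊ : ℝ) ≤ 2 * (2 : ℝ) ^ ((n : ℝ) * R₁) := by
      have : (1 : ℝ) ≤ (2 : ℝ) ^ ((n : ℝ) * R₁) :=
        Real.one_le_rpow (by norm_num) (by positivity)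
      linarith [ceil_sub_one_le n R₁]
    rw [div_le_iff₀ (by positivity), mul_assoc, ← Real.rpow_add (by norm_num)]
    calc _ ≤ (2 : ℝ) ^ ((n : ℝ) * R₀) * (2 * (2 : ℝ) ^ ((n : ℝ) * R₁)) :=
          mul_le_mul (ceil_sub_one_le n R₀) h1 (by positivity) (by positivity)
      _ = 2 * (2 : ℝ) ^ ((n : ℝ) * R₀ + n * R₁) := by rw [Real.rpow_add (by norm_num)]; ring
      _ = _ := by congr 2; ring

/-- Superposition codebooks of growing block length: the confusion probabilities are bounded by a
null sequence while the cost stays at its single-letter mean. -/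
theorem Ensemble.exists_codebooks {A B T Z : Type*} [Fintype A] [Fintype B] [Fintype T]
    [Fintype Z] (E : Ensemble A B T Z) {κ : A → T → Z → ℝ} (hκ : ∀ a t z, 0 ≤ κ a t z)
    {R₀ R₁ : ℝ} (hR₁ : 0 ≤ R₁) (h₀ : R₀ = 0 ∨ R₀ < E.cloudInfo)
    (h₁ : R₁ = 0 ∨ R₁ < E.satelliteInfo) (h₂ : R₀ = 0 ∨ R₀ + R₁ < E.wordInfo) :
    ∃ (γ₀ γ₁ γ₂ ε : ℕ → ℝ), Tendsto ε atTop (𝓝 0) ∧ ∀ (n : ℕ) (l : ℝ), 0 ≤ l →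
      ∃ c : Fin ⌈(2 : ℝ) ^ ((n : ℝ) * R₀)⌉₊ →
          (Fin n → A) × (Fin ⌈(2 : ℝ) ^ ((n : ℝ) * R₁)⌉₊ → Fin n → B),
        (1 / ((⌈(2 : ℝ) ^ ((n : ℝ) * R₀)⌉₊ : ℝ) * (⌈(2 : ℝ) ^ ((n : ℝ) * R₁)⌉₊ : ℝ))) *
          ∑ w₀, ∑ w₁, ∑ t, ∑ z, (E.pow n).V ((c w₀).2 w₁) t z *
            (l * (E.pow n).confusion (γ₀ n) (γ₁ n) (γ₂ n) c w₀ w₁ t z +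
              (1 / (n : ℝ)) * ∑ i, κ ((c w₀).1 i) (t i) (z i)) ≤
          l * ε n + E.mean fun a _ t z => κ a t z := by
  obtain ⟨δ₀, hδ₀, t₀⟩ := exists_margin h₀
  obtain ⟨δ₁, hδ₁, t₁⟩ := exists_margin h₁
  obtain ⟨δ₂, hδ₂, t₂⟩ := exists_margin_pair hR₁ h₂
  have hε := (((((E.tendsto_cloud_miss hδ₀).add (E.tendsto_satellite_miss hδ₁)).add
    (E.tendsto_word_miss hδ₂)).add t₀).add t₁).add t₂
  simp only [add_zero] at hε
  -- Thresholds and null sequence are fixed before `l`; only the codebook depends on `l`, so `l` may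
  -- later grow with `n`.
  refine ⟨fun n => (2 : ℝ) ^ ((n : ℝ) * (E.cloudInfo - δ₀)),
    fun n => (2 : ℝ) ^ ((n : ℝ) * (E.satelliteInfo - δ₁)),
    fun n => (2 : ℝ) ^ ((n : ℝ) * (E.wordInfo - δ₂)), _, hε, fun n l hl => ?_⟩
  obtain ⟨c, hc⟩ := (E.pow n).exists_codebook (M₀ := ⌈(2 : ℝ) ^ ((n : ℝ) * R₀)⌉₊)
    (M₁ := ⌈(2 : ℝ) ^ ((n : ℝ) * R₁)⌉₊) (Nat.ceil_pos.2 (by positivity))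
    (Nat.ceil_pos.2 (by positivity)) (γ₀ := (2 : ℝ) ^ ((n : ℝ) * (E.cloudInfo - δ₀)))
    (γ₁ := (2 : ℝ) ^ ((n : ℝ) * (E.satelliteInfo - δ₁)))
    (γ₂ := (2 : ℝ) ^ ((n : ℝ) * (E.wordInfo - δ₂))) (by positivity) (by positivity)
    (by positivity) hl (fun a t z => (1 / (n : ℝ)) * ∑ i, κ (a i) (t i) (z i))
  exact ⟨c, hc.trans (add_le_add le_rfl (E.pow_mean_average_le hκ))⟩

end ISAC

/-! ### From codebooks to codes for the channel -/

namespace ISAC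

open Filter Topology

theorem average_nonneg {X S Y Z : Type*} [Fintype S] [Fintype Y] [Fintype Z]
    (ch : Channel X S Y Z) {M₀ M₁ n : ℕ} (c : Code X S Y Z M₀ M₁ n)
    {f : Fin M₀ → Fin M₁ → (Fin n → S) → (Fin n → Y) → (Fin n → Z) → ℝ}
    (hf : ∀ w₀ w₁ s y z, 0 ≤ f w₀ w₁ s y z) : 0 ≤ c.average ch f :=
  mul_nonneg (by positivity) <| Finset.sum_nonneg fun _ _ => Finset.sum_nonneg fun _ _ =>
    Finset.sum_nonneg fun _ _ => Finset.sum_nonneg fun _ _ => Finset.sum_nonneg fun _ _ =>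
      mul_nonneg (Finset.prod_nonneg fun _ _ => mul_nonneg (ch.PS_mem.1 _) ((ch.W_mem _ _).1 _))
        (hf _ _ _ _ _)

section Coding

variable {U X S Y Z : Type*} [Fintype U] [Fintype X] [Fintype S] [Fintype Y] [Fintype Z]

open Classical in
/-- The single-letter superposition ensemble of an input law `P` on a channel. -/
noncomputable def letterEnsemble (ch : Channel X S Y Z) (P : U × X → ℝ)
    (hP : P ∈ stdSimplex ℝ (U × X)) : Ensemble U X (S × Y) Z where
  PA u := ∑ x, P (u, x)
  PA_mem := ⟨fun u => Finset.sum_nonneg fun x _ => hP.1 _, by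
    rw [← Fintype.sum_prod_type]; exact hP.2⟩
  -- For `u` of probability zero any law serves; the marginal of `X` is a choice that always exists.
  K u x := if ∑ x, P (u, x) = 0 then ∑ u', P (u', x) else P (u, x) / ∑ x, P (u, x)
  K_mem u := by
    constructor
    · intro x
      split_ifs
      · exact Finset.sum_nonneg fun u _ => hP.1 _
      · exact div_nonneg (hP.1 _) (Finset.sum_nonneg fun x _ => hP.1 _)
    · split_ifs with h
      · rw [← Fintype.sum_prod_type_right]; exact hP.2
      · rw [← Finset.sum_div, div_self h]
  V x t z := ch.PS t.1 * ch.W x t.1 (t.2, z)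
  V_nonneg x t z := mul_nonneg (ch.PS_mem.1 _) ((ch.W_mem _ _).1 _)
  V_sum x := by
    simp only [Fintype.sum_prod_type, ← Finset.mul_sum]
    have : ∀ s, ∑ y, ∑ z, ch.W x s (y, z) = 1 := fun s => by
      rw [← Fintype.sum_prod_type]; exact (ch.W_mem x s).2
    simp [this, ch.PS_mem.2]

variable (ch : Channel X S Y Z) {P : U × X → ℝ} (hP : P ∈ stdSimplex ℝ (U × X))

theorem letterEnsemble_PA_mul_K (u : U) (x : X) :
    (letterEnsemble ch P hP).PA u * (letterEnsemble ch P hP).K u x = P (u, x) := by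
  simp only [letterEnsemble]
  split_ifs with h
  · rw [h, zero_mul]
    exact ((Finset.sum_eq_zero_iff_of_nonneg fun x _ => hP.1 (u, x)).1 h x
      (Finset.mem_univ x)).symm
  · rw [mul_div_cancel₀ _ h]

theorem letterEnsemble_law (ω : Letters U X S Y Z) :
    (letterEnsemble ch P hP).law (rvU ω, rvX ω, (rvS ω, rvY ω), rvZ ω) = jointLaw ch P ω := by
  rw [Ensemble.law, letterEnsemble_PA_mul_K]
  simp only [letterEnsemble, jointLaw, mul_assoc]

theorem letterEnsemble_expect (f : U × X × (S × Y) × Z → ℝ) :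
    expect (letterEnsemble ch P hP).law f =
      expect (jointLaw ch P) fun ω => f (rvU ω, rvX ω, (rvS ω, rvY ω), rvZ ω) := by
  simp only [expect, Fintype.sum_prod_type, ← letterEnsemble_law ch hP, rvU, rvX, rvS, rvY, rvZ]

theorem average_eq {M₀ M₁ n : ℕ} (c : Code X S Y Z M₀ M₁ n)
    (f : Fin M₀ → Fin M₁ → (Fin n → S) → (Fin n → Y) → (Fin n → Z) → ℝ) :
    c.average ch f = (1 / ((M₀ : ℝ) * (M₁ : ℝ))) * ∑ w₀, ∑ w₁, ∑ t : Fin n → S × Y, ∑ z,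
      ((letterEnsemble ch P hP).pow n).V (c.enc w₀ w₁) t z *
        f w₀ w₁ (fun i => (t i).1) (fun i => (t i).2) z := by
  simp only [Code.average, sum_arrow_prod, Ensemble.pow, letterEnsemble]

/-- The test decoders of a codebook: each receiver picks a message that passes its tests. -/
noncomputable def testCode {n M₀ M₁ : ℕ} [Nonempty (Fin M₀)] [Nonempty (Fin M₁)]
    (E : Ensemble (Fin n → U) (Fin n → X) (Fin n → S × Y) (Fin n → Z)) (γ₀ γ₁ γ₂ : ℝ)
    (g : U → Z → S) (c : Fin M₀ → (Fin n → U) × (Fin M₁ → Fin n → X)) :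
    Code X S Y Z M₀ M₁ n where
  enc w₀ w₁ := (c w₀).2 w₁
  -- `Classical.epsilon` returns an arbitrary message if none passes; that case is counted as a
  -- failure of the true one.
  dec₁ y s := Classical.epsilon fun w =>
    E.SatelliteTest γ₁ (c w.1).1 ((c w.1).2 w.2) (fun i => (s i, y i)) ∧
      E.WordTest γ₂ ((c w.1).2 w.2) fun i => (s i, y i)
  dec₂ z := Classical.epsilon fun w => E.CloudTest γ₀ (c w).1 z
  est z i := g ((c (Classical.epsilon fun w => E.CloudTest γ₀ (c w).1 z)).1 i) (z i)

section TestCode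

variable {n M₀ M₁ : ℕ} (E : Ensemble (Fin n → U) (Fin n → X) (Fin n → S × Y) (Fin n → Z))
  (γ₀ γ₁ γ₂ : ℝ) (c : Fin M₀ → (Fin n → U) × (Fin M₁ → Fin n → X))

theorem confusion_terms_nonneg (w₀ : Fin M₀) (w₁ : Fin M₁) (t : Fin n → S × Y) (z : Fin n → Z) :
    0 ≤ ∑ w₀' ∈ Finset.univ.erase w₀, ind (E.CloudTest γ₀ (c w₀').1 z) ∧
    0 ≤ ∑ w₁' ∈ Finset.univ.erase w₁, ind (E.SatelliteTest γ₁ (c w₀).1 ((c w₀).2 w₁') t) ∧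
    0 ≤ ∑ w₀' ∈ Finset.univ.erase w₀, ∑ w₁', ind (E.WordTest γ₂ ((c w₀').2 w₁') t) :=
  ⟨Finset.sum_nonneg fun _ _ => ind_nonneg _, Finset.sum_nonneg fun _ _ => ind_nonneg _,
    Finset.sum_nonneg fun _ _ => Finset.sum_nonneg fun _ _ => ind_nonneg _⟩

theorem confusion_nonneg (w₀ : Fin M₀) (w₁ : Fin M₁) (t : Fin n → S × Y) (z : Fin n → Z) :
    0 ≤ E.confusion γ₀ γ₁ γ₂ c w₀ w₁ t z := by
  obtain ⟨h1, h2, h3⟩ := confusion_terms_nonneg E γ₀ γ₁ γ₂ c w₀ w₁ t z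
  have := ind_nonneg (¬E.CloudTest γ₀ (c w₀).1 z)
  have := ind_nonneg (¬E.SatelliteTest γ₁ (c w₀).1 ((c w₀).2 w₁) t)
  have := ind_nonneg (¬E.WordTest γ₂ ((c w₀).2 w₁) t)
  unfold Ensemble.confusion
  linarith

variable [Nonempty (Fin M₀)] [Nonempty (Fin M₁)] (g : U → Z → S)

/-- Either the true cloud word fails its test, or the decoder's choice is another cloud word that
passes; each event adds one to the count. -/
theorem one_le_confusion_of_dec₂_ne {w₀ : Fin M₀} (w₁ : Fin M₁) (t : Fin n → S × Y)
    {z : Fin n → Z} (h : (testCode E γ₀ γ₁ γ₂ g c).dec₂ z ≠ w₀) :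
    1 ≤ E.confusion γ₀ γ₁ γ₂ c w₀ w₁ t z := by
  obtain ⟨h1, h2, h3⟩ := confusion_terms_nonneg E γ₀ γ₁ γ₂ c w₀ w₁ t z
  have i1 := ind_nonneg (¬E.CloudTest γ₀ (c w₀).1 z)
  have i2 := ind_nonneg (¬E.SatelliteTest γ₁ (c w₀).1 ((c w₀).2 w₁) t)
  have i3 := ind_nonneg (¬E.WordTest γ₂ ((c w₀).2 w₁) t)
  unfold Ensemble.confusion
  by_cases hown : E.CloudTest γ₀ (c w₀).1 z
  · have hs : E.CloudTest γ₀ (c ((testCode E γ₀ γ₁ γ₂ g c).dec₂ z)).1 z :=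
      Classical.epsilon_spec (p := fun w => E.CloudTest γ₀ (c w).1 z) ⟨w₀, hown⟩
    have := Finset.single_le_sum (f := fun w => ind (E.CloudTest γ₀ (c w).1 z))
      (fun w _ => ind_nonneg _) (Finset.mem_erase.2 ⟨h, Finset.mem_univ _⟩)
    simp only [ind_of hs] at this
    linarith
  · rw [ind_of hown]
    linarith

/-- If the true pair passes, a wrong choice with the right cloud passes the satellite test, and one
with a wrong cloud passes the word test. Hence the two tests of the communication receiver. -/
theorem one_le_confusion_of_dec₁_ne {w₀ : Fin M₀} {w₁ : Fin M₁} {t : Fin n → S × Y}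
    (z : Fin n → Z)
    (h : (testCode E γ₀ γ₁ γ₂ g c).dec₁ (fun i => (t i).2) (fun i => (t i).1) ≠ (w₀, w₁)) :
    1 ≤ E.confusion γ₀ γ₁ γ₂ c w₀ w₁ t z := by
  obtain ⟨h1, h2, h3⟩ := confusion_terms_nonneg E γ₀ γ₁ γ₂ c w₀ w₁ t z
  have i1 := ind_nonneg (¬E.CloudTest γ₀ (c w₀).1 z)
  have i2 := ind_nonneg (¬E.SatelliteTest γ₁ (c w₀).1 ((c w₀).2 w₁) t)
  have i3 := ind_nonneg (¬E.WordTest γ₂ ((c w₀).2 w₁) t)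
  unfold Ensemble.confusion
  by_cases hs : E.SatelliteTest γ₁ (c w₀).1 ((c w₀).2 w₁) t
  · by_cases hw : E.WordTest γ₂ ((c w₀).2 w₁) t
    · have hd := Classical.epsilon_spec (p := fun w : Fin M₀ × Fin M₁ =>
        E.SatelliteTest γ₁ (c w.1).1 ((c w.1).2 w.2) t ∧ E.WordTest γ₂ ((c w.1).2 w.2) t)
        ⟨(w₀, w₁), hs, hw⟩
      change Classical.epsilon (fun w : Fin M₀ × Fin M₁ =>
        E.SatelliteTest γ₁ (c w.1).1 ((c w.1).2 w.2) t ∧ E.WordTest γ₂ ((c w.1).2 w.2) t) ≠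
          (w₀, w₁) at h
      generalize Classical.epsilon (fun w : Fin M₀ × Fin M₁ =>
        E.SatelliteTest γ₁ (c w.1).1 ((c w.1).2 w.2) t ∧ E.WordTest γ₂ ((c w.1).2 w.2) t) = w
        at hd h
      obtain ⟨v₀, v₁⟩ := w
      by_cases hv : v₀ = w₀
      · subst hv
        have hne : v₁ ≠ w₁ := fun h' => h (by rw [h'])
        have := Finset.single_le_sum
          (f := fun w => ind (E.SatelliteTest γ₁ (c v₀).1 ((c v₀).2 w) t))
          (fun w _ => ind_nonneg _) (Finset.mem_erase.2 ⟨hne, Finset.mem_univ _⟩)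
        simp only [ind_of hd.1] at this
        linarith
      · have := Finset.single_le_sum
          (f := fun w => ∑ w₁', ind (E.WordTest γ₂ ((c w).2 w₁') t))
          (fun w _ => Finset.sum_nonneg fun _ _ => ind_nonneg _)
          (Finset.mem_erase.2 ⟨hv, Finset.mem_univ _⟩)
        have h' := Finset.single_le_sum (f := fun w => ind (E.WordTest γ₂ ((c v₀).2 w) t))
          (fun w _ => ind_nonneg _) (Finset.mem_univ v₁)
        simp only [ind_of hd.2] at h'
        linarith
    · rw [ind_of hw]
      linarith
  · rw [ind_of hs]
    linarith

end TestCode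

theorem average_le_one {n : ℕ} {f : Fin n → ℝ} (hf : ∀ i, f i ≤ 1) :
    (1 / (n : ℝ)) * ∑ i, f i ≤ 1 := by
  have h : ∑ i, f i ≤ n := (Finset.sum_le_sum fun i _ => hf i).trans_eq (by simp)
  rcases Nat.eq_zero_or_pos n with rfl | hn
  · simp
  · rw [one_div, inv_mul_le_iff₀ (by positivity)]
    linarith

/-- The multiplier is `l + 1` because confusion is paid for twice: `l` units cover the error
probability, and one covers the distortion, at most one, when the cloud word is decoded wrongly.
Otherwise the estimate is `g` applied to the sent cloud word. -/
theorem testCode_performance {n M₀ M₁ : ℕ} [Nonempty (Fin M₀)] [Nonempty (Fin M₁)]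
    {d : S → S → ℝ} (hd0 : ∀ s s', 0 ≤ d s s') (hd1 : ∀ s s', d s s' ≤ 1)
    (γ₀ γ₁ γ₂ : ℝ) (g : U → Z → S) (c : Fin M₀ → (Fin n → U) × (Fin M₁ → Fin n → X))
    {l : ℝ} (hl : 0 ≤ l) :
    l * (testCode ((letterEnsemble ch P hP).pow n) γ₀ γ₁ γ₂ g c).errorProb ch +
        (testCode ((letterEnsemble ch P hP).pow n) γ₀ γ₁ γ₂ g c).distortion ch d ≤
      (1 / ((M₀ : ℝ) * (M₁ : ℝ))) * ∑ w₀, ∑ w₁, ∑ t, ∑ z,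
        ((letterEnsemble ch P hP).pow n).V ((c w₀).2 w₁) t z *
          ((l + 1) * ((letterEnsemble ch P hP).pow n).confusion γ₀ γ₁ γ₂ c w₀ w₁ t z +
            (1 / (n : ℝ)) * ∑ i, d (t i).1 (g ((c w₀).1 i) (z i))) := by
  rw [Code.errorProb, Code.distortion, average_eq ch hP, average_eq ch hP, mul_left_comm,
    ← mul_add]
  refine mul_le_mul_of_nonneg_left ?_ (by positivity)
  simp_rw [Finset.mul_sum (a := l), ← Finset.sum_add_distrib]
  refine Finset.sum_le_sum fun w₀ _ => Finset.sum_le_sum fun w₁ _ => Finset.sum_le_sum fun t _ =>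
    Finset.sum_le_sum fun z _ => ?_
  rw [mul_left_comm, ← mul_add]
  refine mul_le_mul_of_nonneg_left ?_ (Ensemble.V_nonneg _ _ _ _)
  have hc := confusion_nonneg ((letterEnsemble ch P hP).pow n) γ₀ γ₁ γ₂ c w₀ w₁ t z
  have h1 : (if (testCode ((letterEnsemble ch P hP).pow n) γ₀ γ₁ γ₂ g c).dec₁
        (fun i => (t i).2) (fun i => (t i).1) ≠ (w₀, w₁) ∨
      (testCode ((letterEnsemble ch P hP).pow n) γ₀ γ₁ γ₂ g c).dec₂ z ≠ w₀ then (1 : ℝ) else 0) ≤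
      ((letterEnsemble ch P hP).pow n).confusion γ₀ γ₁ γ₂ c w₀ w₁ t z := by
    split_ifs with h
    · rcases h with h | h
      · exact one_le_confusion_of_dec₁_ne _ γ₀ γ₁ γ₂ c g z h
      · exact one_le_confusion_of_dec₂_ne _ γ₀ γ₁ γ₂ c g w₁ t h
    · exact hc
  have h2 : (1 / (n : ℝ)) * ∑ i, d (t i).1
      ((testCode ((letterEnsemble ch P hP).pow n) γ₀ γ₁ γ₂ g c).est z i) ≤
      ((letterEnsemble ch P hP).pow n).confusion γ₀ γ₁ γ₂ c w₀ w₁ t z +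
        (1 / (n : ℝ)) * ∑ i, d (t i).1 (g ((c w₀).1 i) (z i)) := by
    by_cases h : (testCode ((letterEnsemble ch P hP).pow n) γ₀ γ₁ γ₂ g c).dec₂ z = w₀
    · have : ∀ i, (testCode ((letterEnsemble ch P hP).pow n) γ₀ γ₁ γ₂ g c).est z i =
          g ((c w₀).1 i) (z i) := fun i => by rw [← h]; rfl
      simp_rw [this]
      linarith
    · have h3 := one_le_confusion_of_dec₂_ne _ γ₀ γ₁ γ₂ c g w₁ t h
      have h4 := average_le_one fun i => hd1 (t i).1
        ((testCode ((letterEnsemble ch P hP).pow n) γ₀ γ₁ γ₂ g c).est z i)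
      have h5 : 0 ≤ (1 / (n : ℝ)) * ∑ i, d (t i).1 (g ((c w₀).1 i) (z i)) :=
        mul_nonneg (by positivity) (Finset.sum_nonneg fun i _ => hd0 _ _)
      linarith
  have h3 := mul_le_mul_of_nonneg_left h1 hl
  linarith

/-- A family of trade-offs between two nonnegative quantities with arbitrarily large multipliers
yields a sequence along which the first vanishes while the second stays asymptotically bounded. -/
theorem exists_sequence_of_tradeoff {C : ℕ → Type*} {err dist : ∀ n, C n → ℝ}
    (herr : ∀ n c, 0 ≤ err n c) (hdist : ∀ n c, 0 ≤ dist n c) {ε : ℕ → ℝ}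
    (hε : Tendsto ε atTop (𝓝 0)) {D : ℝ}
    (h : ∀ n (l : ℝ), 0 ≤ l → ∃ c, l * err n c + dist n c ≤ (l + 1) * ε n + D) :
    ∃ c : ∀ n, C n, Tendsto (fun n => err n (c n)) atTop (𝓝 0) ∧
      limsup (fun n => dist n (c n)) atTop ≤ D := by
  -- With `l = 1 / η` the error is at most `(1 + η) ε + η D` and the distortion at most `ε / η + ε +
  -- D`. Both limits need `η → 0` and `ε ≤ η ^ 2`; the term `1 / (n + 1)` keeps `η` positive.
  set η : ℕ → ℝ := fun n => √(|ε n| + 1 / ((n : ℝ) + 1)) with hη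
  have hη0 : ∀ n, 0 < η n := fun n => Real.sqrt_pos.2 (by positivity)
  have hηlim : Tendsto η atTop (𝓝 0) := by
    have := (hε.abs.add tendsto_one_div_add_atTop_nhds_zero_nat).sqrt
    simpa [hη] using this
  have hεη : ∀ n, ε n ≤ η n * η n := fun n => by
    rw [hη, Real.mul_self_sqrt (by positivity)]
    have : 0 ≤ 1 / ((n : ℝ) + 1) := by positivity
    linarith [le_abs_self (ε n)]
  choose c hc using fun n => h n (η n)⁻¹ (inv_nonneg.2 (hη0 n).le)
  have hc' : ∀ n, err n (c n) + η n * dist n (c n) ≤ (1 + η n) * ε n + η n * D := fun n => by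
    have h1 := mul_le_mul_of_nonneg_left (hc n) (hη0 n).le
    have h2 : η n * (η n)⁻¹ = 1 := mul_inv_cancel₀ (hη0 n).ne'
    rw [mul_add, mul_add, ← mul_assoc, ← mul_assoc, mul_add, h2] at h1
    linarith
  refine ⟨c, squeeze_zero (g := fun n => (1 + η n) * ε n + η n * D) (fun n => herr n (c n))
    (fun n => ?_) ?_, ?_⟩
  · have := mul_nonneg (hη0 n).le (hdist n (c n))
    linarith [hc' n]
  · simpa using ((hηlim.const_add 1).mul hε).add (hηlim.mul_const D)
  · have hle : ∀ n, dist n (c n) ≤ η n + ε n + D := fun n => by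
      have h1 := mul_nonneg (inv_nonneg.2 (hη0 n).le) (herr n (c n))
      have h2 : (η n)⁻¹ * ε n ≤ η n := by
        rw [inv_mul_le_iff₀ (hη0 n)]
        exact hεη n
      linarith [hc n]
    have hlim : Tendsto (fun n => η n + ε n + D) atTop (𝓝 D) := by
      simpa using (hηlim.add hε).add_const D
    rw [← hlim.limsup_eq]
    exact limsup_le_limsup (Eventually.of_forall hle)
      (IsBoundedUnder.isCoboundedUnder_le ⟨0, eventually_map.2 (Eventually.of_forall fun n =>
        hdist n (c n))⟩) hlim.isBoundedUnder_le

/-- Superposition coding achieves the partial-decoding inner bound. A zero rate needs no strict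
inequality. -/
theorem achievable_of_ensemble {d : S → S → ℝ} (hd0 : ∀ s s', 0 ≤ d s s')
    (hd1 : ∀ s s', d s s' ≤ 1) (g : U → Z → S) {R₀ R₁ : ℝ} (hR₀ : 0 ≤ R₀) (hR₁ : 0 ≤ R₁)
    (h₀ : R₀ = 0 ∨ R₀ < (letterEnsemble ch P hP).cloudInfo)
    (h₁ : R₁ = 0 ∨ R₁ < (letterEnsemble ch P hP).satelliteInfo)
    (h₂ : R₀ = 0 ∨ R₀ + R₁ < (letterEnsemble ch P hP).wordInfo) :
    Achievable ch d R₀ R₁ (expect (jointLaw ch P) fun ω => d (rvS ω) (g (rvU ω) (rvZ ω))) := by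
  obtain ⟨γ₀, γ₁, γ₂, ε, hε, hcode⟩ := (letterEnsemble ch P hP).exists_codebooks
    (κ := fun u t z => d t.1 (g u z)) (fun _ _ _ => hd0 _ _) hR₁ h₀ h₁ h₂
  refine ⟨hR₀, hR₁, exists_sequence_of_tradeoff
    (C := fun n => Code X S Y Z ⌈(2 : ℝ) ^ ((n : ℝ) * R₀)⌉₊ ⌈(2 : ℝ) ^ ((n : ℝ) * R₁)⌉₊ n)
    (err := fun n c => c.errorProb ch) (dist := fun n c => c.distortion ch d)
    (fun n c => average_nonneg ch c fun _ _ _ _ _ => ?_)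
    (fun n c => average_nonneg ch c fun _ _ _ _ _ => mul_nonneg (by positivity)
      (Finset.sum_nonneg fun _ _ => hd0 _ _)) hε fun n l hl => ?_⟩
  · split_ifs <;> norm_num
  · obtain ⟨c, hc⟩ := hcode n (l + 1) (by linarith)
    have : Nonempty (Fin ⌈(2 : ℝ) ^ ((n : ℝ) * R₀)⌉₊) := ⟨⟨0, Nat.ceil_pos.2 (by positivity)⟩⟩
    have : Nonempty (Fin ⌈(2 : ℝ) ^ ((n : ℝ) * R₁)⌉₊) := ⟨⟨0, Nat.ceil_pos.2 (by positivity)⟩⟩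
    refine ⟨testCode ((letterEnsemble ch P hP).pow n) (γ₀ n) (γ₁ n) (γ₂ n) g c, ?_⟩
    refine (testCode_performance ch hP hd0 hd1 (γ₀ n) (γ₁ n) (γ₂ n) g c hl).trans (hc.trans_eq ?_)
    rw [Ensemble.mean_eq_expect, letterEnsemble_expect]

end Coding

end ISAC

/-! ### Information quantities as means of log-likelihood ratios -/

namespace ISAC

section Information

/-- Turns the sums defining information into expectations, so that logarithms need comparing only at
outcomes of positive probability. -/
theorem expect_pair {Ω α β : Type*} [Fintype Ω] [Fintype α] [Fintype β] (P : Ω → ℝ) (A : Ω → α)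
    (B : Ω → β) (f : α → β → ℝ) :
    ∑ a, ∑ b, prob P (fun ω => A ω = a ∧ B ω = b) * f a b =
      expect P fun ω => f (A ω) (B ω) := by
  classical
  simp only [prob, expect, Finset.sum_mul]
  rw [Finset.sum_congr rfl fun a _ => Finset.sum_comm, Finset.sum_comm]
  refine Finset.sum_congr rfl fun ω _ => ?_
  rw [Finset.sum_eq_single (A ω), Finset.sum_eq_single (B ω)]
  · simp
  · intro b _ hb
    simp [hb.symm]
  · simp
  · intro a _ ha
    simp [ha.symm]
  · simp

theorem expect_triple {Ω α β γ : Type*} [Fintype Ω] [Fintype α] [Fintype β] [Fintype γ]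
    (P : Ω → ℝ) (A : Ω → α) (B : Ω → β) (C : Ω → γ) (f : α → β → γ → ℝ) :
    ∑ a, ∑ b, ∑ c, prob P (fun ω => A ω = a ∧ B ω = b ∧ C ω = c) * f a b c =
      expect P fun ω => f (A ω) (B ω) (C ω) := by
  rw [← expect_pair P A (fun ω => (B ω, C ω)) fun a x => f a x.1 x.2]
  simp only [Fintype.sum_prod_type, Prod.mk.injEq]

theorem expect_congr_of_pos {Ω : Type*} [Fintype Ω] {P f g : Ω → ℝ} (hP : ∀ ω, 0 ≤ P ω)
    (h : ∀ ω, 0 < P ω → f ω = g ω) : expect P f = expect P g := by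
  refine Finset.sum_congr rfl fun ω _ => ?_
  rcases (hP ω).eq_or_lt with h0 | h0
  · rw [← h0, zero_mul, zero_mul]
  · rw [h ω h0]

/-- Gibbs' inequality: a mean log-ratio is nonnegative if the denominators, weighted by the
likelihood ratio, have total mass at most one. -/
theorem expect_logb_nonneg {Ω : Type*} [Fintype Ω] {P num den : Ω → ℝ} (hP : P ∈ stdSimplex ℝ Ω)
    (hnum : ∀ x, 0 < P x → 0 < num x) (hden : ∀ x, 0 < P x → 0 < den x)
    (hsum : expect P (fun x => den x / num x) ≤ 1) :
    0 ≤ expect P fun x => Real.logb 2 (num x / den x) := by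
  have hlog : (0 : ℝ) < Real.log 2 := Real.log_pos (by norm_num)
  -- This is `1 - 1 / r ≤ log r` at `r = num / den`, with `log 2` converting bits to nats.
  have h : ∀ x, P x * (1 - den x / num x) ≤ P x * Real.logb 2 (num x / den x) * Real.log 2 := by
    intro x
    rcases (hP.1 x).eq_or_lt with h0 | h0
    · simp [← h0]
    · have h1 := Real.one_sub_inv_le_log_of_pos (div_pos (hnum x h0) (hden x h0))
      rw [inv_div] at h1
      rw [Real.logb, mul_assoc, div_mul_cancel₀ _ hlog.ne']
      exact mul_le_mul_of_nonneg_left h1 h0.le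
  have h2 := Finset.sum_le_sum fun x (_ : x ∈ Finset.univ) => h x
  rw [← Finset.sum_mul] at h2
  simp only [mul_sub, mul_one, Finset.sum_sub_distrib, hP.2] at h2
  simp only [expect] at hsum ⊢
  by_contra! hneg
  nlinarith [mul_neg_of_neg_of_pos hneg hlog]

namespace Ensemble

variable {A B T Z : Type*} [Fintype A] [Fintype B] [Fintype T] [Fintype Z]
  (E : Ensemble A B T Z)

theorem out₂_sum : ∑ z, E.out₂ z = 1 := by
  unfold out₂
  rw [Finset.sum_comm]
  simp [← Finset.mul_sum, E.cloud₂_sum, E.PA_mem.2]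

theorem cloud₁_sum (a : A) : ∑ t, E.cloud₁ a t = 1 := by
  unfold cloud₁
  rw [Finset.sum_comm]
  simp [← Finset.mul_sum, E.V₁_sum, (E.K_mem a).2]

theorem out₂_nonneg (z : Z) : 0 ≤ E.out₂ z :=
  Finset.sum_nonneg fun _ _ => mul_nonneg (E.PA_mem.1 _) (E.cloud₂_nonneg _ _)

theorem out₁_sum : ∑ t, E.out₁ t = 1 := by
  unfold out₁
  rw [Finset.sum_comm]
  simp [← Finset.mul_sum, E.cloud₁_sum, E.PA_mem.2]

theorem out₁_nonneg (t : T) : 0 ≤ E.out₁ t :=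
  Finset.sum_nonneg fun _ _ => mul_nonneg (E.PA_mem.1 _) (E.cloud₁_nonneg _ _)

theorem expect_cloud (f : A → Z → ℝ) :
    expect E.law (fun x => f x.1 x.2.2.2) = ∑ a, E.PA a * ∑ z, E.cloud₂ a z * f a z := by
  rw [← E.mean_eq_expect fun a _ _ z => f a z]
  refine Finset.sum_congr rfl fun a _ => ?_
  simp only [cloud₂, V₂, Finset.mul_sum, Finset.sum_mul]
  simp only [Finset.sum_comm (s := (Finset.univ : Finset Z))]
  refine Finset.sum_congr rfl fun b _ => Finset.sum_congr rfl fun t _ =>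
    Finset.sum_congr rfl fun z _ => by ring

theorem expect_word (f : A → B → T → ℝ) :
    expect E.law (fun x => f x.1 x.2.1 x.2.2.1) =
      ∑ a, E.PA a * ∑ b, E.K a b * ∑ t, E.V₁ b t * f a b t := by
  rw [← E.mean_eq_expect fun a b t _ => f a b t]
  simp only [mean, V₁, Finset.mul_sum, Finset.sum_mul, mul_assoc]

/-- Only an inequality: at `y = 0` the quotient is zero and the mass `x` is lost. Gibbs' inequality
needs no more than a total of at most one. -/
theorem mul_div_le_of_nonneg {x y : ℝ} (hx : 0 ≤ x) : y * (x / y) ≤ x := by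
  rcases eq_or_ne y 0 with rfl | hy
  · simpa using hx
  · rw [mul_div_cancel₀ _ hy]

theorem cloudInfo_nonneg : 0 ≤ E.cloudInfo := by
  refine expect_logb_nonneg E.law_mem (fun x h => E.cloud₂_pos h) (fun x h => E.out₂_pos h) ?_
  rw [E.expect_cloud fun a z => E.out₂ z / E.cloud₂ a z]
  calc _ ≤ ∑ a, E.PA a * ∑ z, E.out₂ z := Finset.sum_le_sum fun a _ =>
        mul_le_mul_of_nonneg_left (Finset.sum_le_sum fun z _ =>
          mul_div_le_of_nonneg (E.out₂_nonneg z)) (E.PA_mem.1 a)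
    _ = 1 := by simp [E.out₂_sum, E.PA_mem.2]

theorem satelliteInfo_nonneg : 0 ≤ E.satelliteInfo := by
  refine expect_logb_nonneg E.law_mem (fun x h => E.V₁_pos h) (fun x h => E.cloud₁_pos h) ?_
  rw [E.expect_word fun a b t => E.cloud₁ a t / E.V₁ b t]
  calc _ ≤ ∑ a, E.PA a * ∑ b, E.K a b * ∑ t, E.cloud₁ a t := Finset.sum_le_sum fun a _ =>
        mul_le_mul_of_nonneg_left (Finset.sum_le_sum fun b _ => mul_le_mul_of_nonneg_left
          (Finset.sum_le_sum fun t _ => mul_div_le_of_nonneg (E.cloud₁_nonneg a t))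
          ((E.K_mem a).1 b)) (E.PA_mem.1 a)
    _ = 1 := by simp [E.cloud₁_sum, (E.K_mem _).2, E.PA_mem.2]

theorem wordInfo_nonneg : 0 ≤ E.wordInfo := by
  refine expect_logb_nonneg E.law_mem (fun x h => E.V₁_pos h) (fun x h => E.out₁_pos h) ?_
  rw [E.expect_word fun _ b t => E.out₁ t / E.V₁ b t]
  calc _ ≤ ∑ a, E.PA a * ∑ b, E.K a b * ∑ t, E.out₁ t := Finset.sum_le_sum fun a _ =>
        mul_le_mul_of_nonneg_left (Finset.sum_le_sum fun b _ => mul_le_mul_of_nonneg_left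
          (Finset.sum_le_sum fun t _ => mul_div_le_of_nonneg (E.out₁_nonneg t))
          ((E.K_mem a).1 b)) (E.PA_mem.1 a)
    _ = 1 := by simp [E.out₁_sum, (E.K_mem _).2, E.PA_mem.2]

end Ensemble

theorem PS_pos {U X S Y Z : Type*} [Fintype S] [Fintype Y] [Fintype Z] (ch : Channel X S Y Z)
    {P : U × X → ℝ} {ω : Letters U X S Y Z} (h : 0 < jointLaw ch P ω) : 0 < ch.PS (rvS ω) :=
  (ch.PS_mem.1 _).lt_of_ne' fun h0 => by simp [jointLaw, h0] at h

/-! ### Single-letter marginals and information identities -/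

section Letters

variable {U X S Y Z : Type*} [Fintype U] [Fintype X] [Fintype S] [Fintype Y] [Fintype Z]
  (ch : Channel X S Y Z) {P : U × X → ℝ} (hP : P ∈ stdSimplex ℝ (U × X))

theorem jointLaw_mem (hP : P ∈ stdSimplex ℝ (U × X)) :
    jointLaw ch P ∈ stdSimplex ℝ (Letters U X S Y Z) := by
  have h := letterEnsemble_expect ch hP fun _ => 1
  simp only [expect, mul_one, (letterEnsemble ch P hP).law_mem.2] at h
  exact ⟨fun ω => by rw [← letterEnsemble_law ch hP]; exact Ensemble.law_nonneg _ _, h.symm⟩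

theorem letterEnsemble_V_sum (x : X) (s : S) :
    ∑ y, ∑ z, (letterEnsemble ch P hP).V x (s, y) z = ch.PS s := by
  have : ∑ y, ∑ z, ch.W x s (y, z) = 1 := by
    rw [← Fintype.sum_prod_type]; exact (ch.W_mem x s).2
  simp only [letterEnsemble, ← Finset.mul_sum, this, mul_one]

theorem letterEnsemble_V_total (x : X) :
    ∑ s, ∑ y, ∑ z, (letterEnsemble ch P hP).V x (s, y) z = 1 := by
  simp only [letterEnsemble_V_sum, ch.PS_mem.2]

theorem prob_UZ (u : U) (z : Z) :
    prob (jointLaw ch P) (fun ω => rvU ω = u ∧ rvZ ω = z) =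
      (letterEnsemble ch P hP).PA u * (letterEnsemble ch P hP).cloud₂ u z := by
  classical
  simp only [prob, ← letterEnsemble_law ch hP, Ensemble.law, Fintype.sum_prod_type, rvU, rvX, rvS,
    rvY, rvZ, ite_and, Finset.sum_ite_irrel, Finset.sum_const_zero,
    Finset.sum_ite_eq', Finset.mem_univ, if_true]
  simp only [Ensemble.cloud₂, Ensemble.V₂, Fintype.sum_prod_type, Finset.mul_sum, mul_assoc]

theorem prob_U (u : U) :
    prob (jointLaw ch P) (fun ω => rvU ω = u) =
      (letterEnsemble ch P hP).PA u := by
  classical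
  simp only [prob, ← letterEnsemble_law ch hP, Ensemble.law, Fintype.sum_prod_type, rvU, rvX, rvS,
    rvY, rvZ, Finset.sum_ite_irrel, Finset.sum_const_zero,
    Finset.sum_ite_eq', Finset.mem_univ, if_true]
  simp only [← Finset.mul_sum, letterEnsemble_V_total, mul_one, ((letterEnsemble ch P hP).K_mem _).2]

theorem prob_X (x : X) :
    prob (jointLaw ch P) (fun ω => rvX ω = x) =
      ∑ u, (letterEnsemble ch P hP).PA u * (letterEnsemble ch P hP).K u x := by
  classical
  simp only [prob, ← letterEnsemble_law ch hP, Ensemble.law, Fintype.sum_prod_type, rvU, rvX, rvS,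
    rvY, rvZ, Finset.sum_ite_irrel, Finset.sum_const_zero,
    Finset.sum_ite_eq', Finset.mem_univ, if_true]
  simp only [← Finset.mul_sum, letterEnsemble_V_total, mul_one]

theorem prob_Z (z : Z) :
    prob (jointLaw ch P) (fun ω => rvZ ω = z) =
      (letterEnsemble ch P hP).out₂ z := by
  classical
  simp only [prob, ← letterEnsemble_law ch hP, Ensemble.law, Fintype.sum_prod_type, rvU, rvX, rvS,
    rvY, rvZ, Finset.sum_ite_eq', Finset.mem_univ, if_true]
  simp only [Ensemble.out₂, Ensemble.cloud₂, Ensemble.V₂, Fintype.sum_prod_type, Finset.mul_sum,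
    mul_assoc]

theorem prob_S (hP : P ∈ stdSimplex ℝ (U × X)) (s : S) :
    prob (jointLaw ch P) (fun ω => rvS ω = s) =
      ch.PS s := by
  classical
  simp only [prob, ← letterEnsemble_law ch hP, Ensemble.law, Fintype.sum_prod_type, rvU, rvX, rvS,
    rvY, rvZ, Finset.sum_ite_irrel, Finset.sum_const_zero,
    Finset.sum_ite_eq', Finset.mem_univ, if_true]
  simp only [← Finset.mul_sum, letterEnsemble_V_sum]
  simp only [← Finset.sum_mul, ← Finset.mul_sum, ((letterEnsemble ch P hP).K_mem _).2,
    ((letterEnsemble ch P hP).PA_mem).2, mul_one, one_mul]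

theorem prob_US (u : U) (s : S) :
    prob (jointLaw ch P) (fun ω => (rvU ω, rvS ω) = (u, s)) =
      (letterEnsemble ch P hP).PA u * ch.PS s := by
  classical
  simp only [prob, ← letterEnsemble_law ch hP, Ensemble.law, Fintype.sum_prod_type, rvU, rvX, rvS,
    rvY, rvZ, Prod.mk.injEq, ite_and, Finset.sum_ite_irrel, Finset.sum_const_zero,
    Finset.sum_ite_eq', Finset.mem_univ, if_true]
  simp only [← Finset.mul_sum, letterEnsemble_V_sum]
  simp only [← Finset.sum_mul, ← Finset.mul_sum, ((letterEnsemble ch P hP).K_mem _).2, mul_one]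

theorem prob_XS (x : X) (s : S) :
    prob (jointLaw ch P) (fun ω => rvX ω = x ∧ rvS ω = s) =
      (∑ u, (letterEnsemble ch P hP).PA u * (letterEnsemble ch P hP).K u x) * ch.PS s := by
  classical
  simp only [prob, ← letterEnsemble_law ch hP, Ensemble.law, Fintype.sum_prod_type, rvU, rvX, rvS,
    rvY, rvZ, ite_and, Finset.sum_ite_irrel, Finset.sum_const_zero,
    Finset.sum_ite_eq', Finset.mem_univ, if_true]
  simp only [← Finset.mul_sum, letterEnsemble_V_sum]
  simp only [Finset.sum_mul]

theorem prob_XUS (x : X) (u : U) (s : S) :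
    prob (jointLaw ch P) (fun ω => rvX ω = x ∧ (rvU ω, rvS ω) = (u, s)) =
      (letterEnsemble ch P hP).PA u * (letterEnsemble ch P hP).K u x * ch.PS s := by
  classical
  simp only [prob, ← letterEnsemble_law ch hP, Ensemble.law, Fintype.sum_prod_type, rvU, rvX, rvS,
    rvY, rvZ, Prod.mk.injEq, ite_and, Finset.sum_ite_irrel, Finset.sum_const_zero,
    Finset.sum_ite_eq', Finset.mem_univ, if_true]
  simp only [← Finset.mul_sum, letterEnsemble_V_sum]

theorem prob_YS (y : Y) (s : S) :
    prob (jointLaw ch P) (fun ω => rvY ω = y ∧ rvS ω = s) =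
      (letterEnsemble ch P hP).out₁ (s, y) := by
  classical
  simp only [prob, ← letterEnsemble_law ch hP, Ensemble.law, Fintype.sum_prod_type, rvU, rvX, rvS,
    rvY, rvZ, ite_and, Finset.sum_ite_irrel, Finset.sum_const_zero,
    Finset.sum_ite_eq', Finset.mem_univ, if_true]
  simp only [Ensemble.out₁, Ensemble.cloud₁, Ensemble.V₁, Finset.mul_sum, mul_assoc]

theorem prob_YUS (y : Y) (u : U) (s : S) :
    prob (jointLaw ch P) (fun ω => rvY ω = y ∧ (rvU ω, rvS ω) = (u, s)) =
      (letterEnsemble ch P hP).PA u * (letterEnsemble ch P hP).cloud₁ u (s, y) := by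
  classical
  simp only [prob, ← letterEnsemble_law ch hP, Ensemble.law, Fintype.sum_prod_type, rvU, rvX, rvS,
    rvY, rvZ, Prod.mk.injEq, ite_and, Finset.sum_ite_irrel, Finset.sum_const_zero,
    Finset.sum_ite_eq', Finset.mem_univ, if_true]
  simp only [Ensemble.cloud₁, Ensemble.V₁, Finset.mul_sum, mul_assoc]

theorem prob_XYS (x : X) (y : Y) (s : S) :
    prob (jointLaw ch P) (fun ω => rvX ω = x ∧ rvY ω = y ∧ rvS ω = s) =
      (∑ u, (letterEnsemble ch P hP).PA u * (letterEnsemble ch P hP).K u x) * (letterEnsemble ch P hP).V₁ x (s, y) := by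
  classical
  simp only [prob, ← letterEnsemble_law ch hP, Ensemble.law, Fintype.sum_prod_type, rvU, rvX, rvS,
    rvY, rvZ, ite_and, Finset.sum_ite_irrel, Finset.sum_const_zero,
    Finset.sum_ite_eq', Finset.mem_univ, if_true]
  rw [Finset.sum_mul]
  simp only [Ensemble.V₁, Finset.mul_sum, mul_assoc]

theorem prob_XYUS (x : X) (y : Y) (u : U) (s : S) :
    prob (jointLaw ch P) (fun ω => rvX ω = x ∧ rvY ω = y ∧ (rvU ω, rvS ω) = (u, s)) =
      (letterEnsemble ch P hP).PA u * (letterEnsemble ch P hP).K u x * (letterEnsemble ch P hP).V₁ x (s, y) := by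
  classical
  simp only [prob, ← letterEnsemble_law ch hP, Ensemble.law, Fintype.sum_prod_type, rvU, rvX, rvS,
    rvY, rvZ, Prod.mk.injEq, ite_and, Finset.sum_ite_irrel, Finset.sum_const_zero,
    Finset.sum_ite_eq', Finset.mem_univ, if_true]
  simp only [Ensemble.V₁, Finset.mul_sum, mul_assoc]

theorem pos_of_jointLaw_pos {ω : Letters U X S Y Z} (h : 0 < jointLaw ch P ω) :
    0 < (letterEnsemble ch P hP).law (rvU ω, rvX ω, (rvS ω, rvY ω), rvZ ω) := by
  rwa [letterEnsemble_law]

theorem mutualInfo_UZ :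
    mutualInfo (jointLaw ch P) rvU rvZ = (letterEnsemble ch P hP).cloudInfo := by
  rw [mutualInfo, expect_pair (jointLaw ch P) rvU rvZ fun u z => Real.logb 2
    (prob (jointLaw ch P) (fun ω => rvU ω = u ∧ rvZ ω = z) /
      (prob (jointLaw ch P) (fun ω => rvU ω = u) * prob (jointLaw ch P) (fun ω => rvZ ω = z))),
    Ensemble.cloudInfo, letterEnsemble_expect]
  refine expect_congr_of_pos (jointLaw_mem ch hP).1 fun ω h => ?_
  have h' := Ensemble.pos_of_law_pos _ (pos_of_jointLaw_pos ch hP h)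
  rw [prob_UZ ch hP, prob_U ch hP, prob_Z ch hP, mul_div_mul_left _ _ h'.1.ne']

/-- Since `S` is independent of `(U, X)`, its mass cancels together with that of `(U, X)`, leaving
the satellite likelihood ratio with output `(S, Y)`: in effect `I(X;Y|U,S) = I(X;S,Y|U)`. -/
theorem condMutualInfo_XY_US :
    condMutualInfo (jointLaw ch P) rvX rvY (fun ω => (rvU ω, rvS ω)) =
      (letterEnsemble ch P hP).satelliteInfo := by
  rw [condMutualInfo, expect_triple (jointLaw ch P) rvX rvY (fun ω => (rvU ω, rvS ω))
    fun x y c => Real.logb 2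
      (prob (jointLaw ch P) (fun ω => rvX ω = x ∧ rvY ω = y ∧ (rvU ω, rvS ω) = c) *
        prob (jointLaw ch P) (fun ω => (rvU ω, rvS ω) = c) /
      (prob (jointLaw ch P) (fun ω => rvX ω = x ∧ (rvU ω, rvS ω) = c) *
        prob (jointLaw ch P) (fun ω => rvY ω = y ∧ (rvU ω, rvS ω) = c))),
    Ensemble.satelliteInfo, letterEnsemble_expect]
  refine expect_congr_of_pos (jointLaw_mem ch hP).1 fun ω h => ?_
  have h' := Ensemble.pos_of_law_pos _ (pos_of_jointLaw_pos ch hP h)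
  have hc := Ensemble.cloud₁_pos _ (pos_of_jointLaw_pos ch hP h)
  have hs := PS_pos ch h
  rw [prob_XYUS ch hP, prob_US ch hP, prob_XUS ch hP, prob_YUS ch hP]
  congr 1
  have h1 := h'.1.ne'
  have h2 := h'.2.1.ne'
  have h3 := hc.ne'
  have h4 := hs.ne'
  simp only at h1 h2 h3
  field_simp

theorem condMutualInfo_XY_S :
    condMutualInfo (jointLaw ch P) rvX rvY rvS = (letterEnsemble ch P hP).wordInfo := by
  rw [condMutualInfo, expect_triple (jointLaw ch P) rvX rvY rvS
    fun x y c => Real.logb 2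
      (prob (jointLaw ch P) (fun ω => rvX ω = x ∧ rvY ω = y ∧ rvS ω = c) *
        prob (jointLaw ch P) (fun ω => rvS ω = c) /
      (prob (jointLaw ch P) (fun ω => rvX ω = x ∧ rvS ω = c) *
        prob (jointLaw ch P) (fun ω => rvY ω = y ∧ rvS ω = c))),
    Ensemble.wordInfo, letterEnsemble_expect]
  refine expect_congr_of_pos (jointLaw_mem ch hP).1 fun ω h => ?_
  have h' := Ensemble.pos_of_law_pos _ (pos_of_jointLaw_pos ch hP h)
  have hc := Ensemble.out₁_pos _ (pos_of_jointLaw_pos ch hP h)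
  have hs := PS_pos ch h
  have hX : 0 < ∑ u, (letterEnsemble ch P hP).PA u * (letterEnsemble ch P hP).K u (rvX ω) :=
    (mul_pos h'.1 h'.2.1).trans_le (Finset.single_le_sum
      (f := fun u => (letterEnsemble ch P hP).PA u * (letterEnsemble ch P hP).K u (rvX ω))
      (fun u _ => mul_nonneg ((letterEnsemble ch P hP).PA_mem.1 u)
        (((letterEnsemble ch P hP).K_mem u).1 _)) (Finset.mem_univ (rvU ω)))
  rw [prob_XYS ch hP, prob_S ch hP, prob_XS ch hP, prob_YS ch hP]
  congr 1
  have h3 := hc.ne'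
  have h4 := hs.ne'
  have h5 := hX.ne'
  simp only at h3
  field_simp

end Letters

end Information

/-! ### The partial-decoding inner bound and its closure -/

section Region

variable {U X S Y Z : Type*} [Fintype U] [Fintype X] [Fintype S] [Fintype Y] [Fintype Z]
  (ch : Channel X S Y Z) {P : U × X → ℝ}

theorem achievable_of_lt (hP : P ∈ stdSimplex ℝ (U × X)) {d : S → S → ℝ}
    (hd0 : ∀ s s', 0 ≤ d s s') (hd1 : ∀ s s', d s s' ≤ 1) (g : U → Z → S) {R₀ R₁ : ℝ}
    (hR₀ : 0 ≤ R₀) (hR₁ : 0 ≤ R₁) (h₀ : R₀ = 0 ∨ R₀ < mutualInfo (jointLaw ch P) rvU rvZ)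
    (h₁ : R₁ = 0 ∨ R₁ < condMutualInfo (jointLaw ch P) rvX rvY fun ω => (rvU ω, rvS ω))
    (h₂ : R₀ = 0 ∨ R₀ + R₁ < condMutualInfo (jointLaw ch P) rvX rvY rvS) :
    Achievable ch d R₀ R₁ (expect (jointLaw ch P) fun ω => d (rvS ω) (g (rvU ω) (rvZ ω))) := by
  rw [mutualInfo_UZ ch hP] at h₀
  rw [condMutualInfo_XY_US ch hP] at h₁
  rw [condMutualInfo_XY_S ch hP] at h₂
  exact achievable_of_ensemble ch hP hd0 hd1 g hR₀ hR₁ h₀ h₁ h₂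

open Filter Topology in
/-- The closed partial-decoding inner bound lies in the capacity-distortion region. -/
theorem mem_region_of_le (hP : P ∈ stdSimplex ℝ (U × X)) {d : S → S → ℝ}
    (hd0 : ∀ s s', 0 ≤ d s s') (hd1 : ∀ s s', d s s' ≤ 1) (g : U → Z → S) {R₀ R₁ : ℝ}
    (hR₀ : 0 ≤ R₀) (hR₁ : 0 ≤ R₁) (h₀ : R₀ ≤ mutualInfo (jointLaw ch P) rvU rvZ)
    (h₁ : R₁ ≤ condMutualInfo (jointLaw ch P) rvX rvY fun ω => (rvU ω, rvS ω))
    (h₂ : R₀ + R₁ ≤ condMutualInfo (jointLaw ch P) rvX rvY rvS) :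
    (R₀, R₁, expect (jointLaw ch P) fun ω => d (rvS ω) (g (rvU ω) (rvZ ω))) ∈
      capacityDistortionRegion ch d := by
  set D := expect (jointLaw ch P) fun ω => d (rvS ω) (g (rvU ω) (rvZ ω)) with hD
  -- Scaling by `r < 1` makes each constraint with a positive left side strict and keeps zero rates
  -- zero, so degenerate cases with vanishing information are covered too.
  have hlim : Tendsto (fun r : ℝ => (r * R₀, r * R₁, D)) (𝓝[<] 1) (𝓝 (R₀, R₁, D)) := by
    have : Continuous fun r : ℝ => (r * R₀, r * R₁, D) := by fun_prop
    simpa using (this.tendsto 1).mono_left nhdsWithin_le_nhds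
  refine mem_closure_of_tendsto hlim ?_
  filter_upwards [Ioo_mem_nhdsLT (show (0 : ℝ) < 1 by norm_num)] with r hr
  have scale : ∀ {R I : ℝ}, 0 < R → R ≤ I → r * R < I := fun hR h => by nlinarith [hr.2]
  refine achievable_of_lt ch hP hd0 hd1 g (mul_nonneg hr.1.le hR₀) (mul_nonneg hr.1.le hR₁) ?_ ?_ ?_
  · exact hR₀.eq_or_lt.imp (fun h => by rw [← h, mul_zero]) fun h => scale h h₀
  · exact hR₁.eq_or_lt.imp (fun h => by rw [← h, mul_zero]) fun h => scale h h₁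
  · exact hR₀.eq_or_lt.imp (fun h => by rw [← h, mul_zero]) fun h => by
      rw [← mul_add]; exact scale (by linarith) h₂

/-- Every channel has an optimal one-shot estimator. -/
theorem exists_isOneShotOptimal [Nonempty S] (L : Letters U X S Y Z → ℝ) (d : S → S → ℝ) :
    ∃ g : U → Z → S, IsOneShotOptimal L d g := by
  choose g hg using fun (u : U) (z : Z) =>
    Finite.exists_min fun s' : S => ∑ s, posterior L s u z * d s s'
  exact ⟨g, fun u z s' => hg u z s'⟩

end Region

end ISAC

/-! ### The binary example -/

namespace ISAC

section Example

variable {q a e : ℝ} (hq : q ∈ Set.Icc (0 : ℝ) 1) (he : e ∈ Set.Icc (0 : ℝ) 1)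
  {P : Fin 3 × Fin 2 → ℝ}

theorem exampleChannel_word_sum (x s y : Fin 2) :
    ∑ z, (exampleChannel q a e hq he).PS s * (exampleChannel q a e hq he).W x s (y, z) =
      if y = s * x then bern q s else 0 := by
  have h : ∑ z, exampleW a e x s (y, z) = if y = s * x then 1 else 0 := by
    unfold exampleW
    rw [Finset.sum_comm]
    by_cases hy : y = s * x
    · simp [hy, (bern_mem he).2]
    · simp [hy]
  simp only [exampleChannel, ← Finset.mul_sum, h]
  split_ifs <;> simp

theorem mul_logb_self_div {x y : ℝ} (hy : y ≠ 0) :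
    x * y * Real.logb 2 (x * y * y / (x * y * y)) = 0 := by
  rcases eq_or_ne x 0 with rfl | hx
  · simp
  · rw [div_self (by positivity), Real.logb_one, mul_zero]

theorem mul_logb_erasure {x y : ℝ} (hy : y ≠ 0) :
    x * y * Real.logb 2 (x * y * y / (x * y * (x * y))) = -(y * (x * Real.logb 2 x)) := by
  rcases eq_or_ne x 0 with rfl | hx
  · simp
  · have : x * y * y / (x * y * (x * y)) = x⁻¹ := by field_simp
    rw [this, Real.logb_inv]
    ring

/-- For `S = 0` the output is constant and every logarithm vanishes (`mul_logb_self_div`). For `S =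
1` the output equals `X`, and the terms add up to `q` times the entropy of `X` (`mul_logb_erasure`).
-/
theorem example_condMutualInfo (hq' : q ∈ Set.Ioo (0 : ℝ) 1)
    (hP : P ∈ stdSimplex ℝ (Fin 3 × Fin 2)) :
    condMutualInfo (jointLaw (exampleChannel q a e hq he) P) rvX rvY rvS =
      q * H2 (prob (jointLaw (exampleChannel q a e hq he) P) fun ω => rvX ω = 0) := by
  set ch := exampleChannel q a e hq he with hch
  have hV : ∀ x s y, (letterEnsemble ch P hP).V₁ x (s, y) = if y = s * x then bern q s else 0 :=
    fun x s y => exampleChannel_word_sum hq he x s y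
  have hS : ch.PS = bern q := rfl
  set PX : Fin 2 → ℝ := fun x => ∑ u, (letterEnsemble ch P hP).PA u *
    (letterEnsemble ch P hP).K u x with hPX
  have hXsum : PX 0 + PX 1 = 1 := by
    have := hP.2
    rw [Fintype.sum_prod_type_right, Fin.sum_univ_two] at this
    simpa only [hPX, letterEnsemble_PA_mul_K] using this
  have hout : ∀ s y, (letterEnsemble ch P hP).out₁ (s, y) =
      PX 0 * (letterEnsemble ch P hP).V₁ 0 (s, y) + PX 1 * (letterEnsemble ch P hP).V₁ 1 (s, y) := by
    intro s y
    simp only [Ensemble.out₁, Ensemble.cloud₁, Fin.sum_univ_two, hPX, Finset.sum_mul, mul_add,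
      Finset.sum_add_distrib, mul_assoc]
  simp only [condMutualInfo, prob_XYS ch hP, prob_S ch hP, prob_XS ch hP, prob_YS ch hP,
    prob_X ch hP, hout, hV, hS]
  change ∑ x, ∑ y, ∑ s, (PX x * _) * Real.logb 2 ((PX x * _) * _ / ((PX x * _) * _)) =
    q * H2 (PX 0)
  have h1 : PX 1 = 1 - PX 0 := by linarith
  have hq0 : q ≠ 0 := hq'.1.ne'
  have hq1 : 1 - q ≠ 0 := (sub_pos.2 hq'.2).ne'
  have e0 := mul_logb_self_div (x := PX 0) hq1
  have e1 := mul_logb_self_div (x := PX 1) hq1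
  have e2 := mul_logb_erasure (x := PX 0) hq0
  have e3 := mul_logb_erasure (x := PX 1) hq0
  have hs : PX 0 * (1 - q) + PX 1 * (1 - q) = 1 - q := by rw [← add_mul, hXsum, one_mul]
  simp only [Fin.sum_univ_two, bern]
  simp [hs]
  rw [e0, e1, e2, e3, H2, ← h1]
  ring

/-- The MAP rule: the posterior error times the mass of the observation is
the smaller of the two joint masses. -/
theorem mass_mul_map_error {m₀ m₁ : ℝ} (h₀ : 0 ≤ m₀) (h₁ : 0 ≤ m₁) :
    (m₀ + m₁) * (if 1 / 2 ≤ m₁ / (m₀ + m₁) then 1 - m₁ / (m₀ + m₁) else m₁ / (m₀ + m₁)) =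
      min m₀ m₁ := by
  rcases (add_nonneg h₀ h₁).eq_or_lt with h | h
  · have h₀' : m₀ = 0 := by linarith
    have h₁' : m₁ = 0 := by linarith
    simp [h₀', h₁']
  · split_ifs with hm <;> rw [le_div_iff₀ h] at hm
    · rw [min_eq_left (by linarith)]
      field_simp
      ring
    · rw [min_eq_right (by linarith), mul_div_cancel₀ _ h.ne']

theorem prob_add_of_binary {Ω : Type*} [Fintype Ω] (P : Ω → ℝ) (B : Ω → Fin 2) (A : Ω → Prop) :
    prob P A = prob P (fun ω => B ω = 0 ∧ A ω) + prob P fun ω => B ω = 1 ∧ A ω := by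
  simp only [prob, ← Finset.sum_add_distrib]
  refine Finset.sum_congr rfl fun ω _ => ?_
  obtain h | h : B ω = 0 ∨ B ω = 1 := by
    generalize B ω = b
    fin_cases b <;> simp
  all_goals by_cases hA : A ω <;> simp [h, hA]

/-- An optimal one-shot estimator of a binary state under Hamming distortion errs on the less
likely state. -/
theorem optimal_error_mass {U X Y Z : Type*} [Fintype U] [Fintype X] [Fintype Y] [Fintype Z]
    {L : Letters U X (Fin 2) Y Z → ℝ} (hL : ∀ ω, 0 ≤ L ω) {g : U → Z → Fin 2}
    (hg : IsOneShotOptimal L hamming g) (u : U) (z : Z) :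
    ∑ s, prob L (fun ω => rvS ω = s ∧ rvU ω = u ∧ rvZ ω = z) * hamming s (g u z) =
      min (prob L fun ω => rvS ω = 0 ∧ rvU ω = u ∧ rvZ ω = z)
        (prob L fun ω => rvS ω = 1 ∧ rvU ω = u ∧ rvZ ω = z) := by
  set m : Fin 2 → ℝ := fun s => prob L fun ω => rvS ω = s ∧ rvU ω = u ∧ rvZ ω = z with hm
  have hm0 : ∀ s, 0 ≤ m s := fun s => Finset.sum_nonneg fun ω _ => by
    split_ifs
    · exact hL ω
    · exact le_rfl
  have htot : prob L (fun ω => rvU ω = u ∧ rvZ ω = z) = m 0 + m 1 :=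
    prob_add_of_binary L rvS _
  change ∑ s, m s * hamming s (g u z) = min (m 0) (m 1)
  -- Optimality is multiplied by the mass of the observation; if that mass is zero, both joint
  -- masses vanish and nothing is claimed.
  have key : ∀ s', ∑ s, m s * hamming s (g u z) ≤ ∑ s, m s * hamming s s' := by
    intro s'
    rcases (add_nonneg (hm0 0) (hm0 1)).eq_or_lt with h | h
    · have h0 : m 0 = 0 := by linarith [hm0 0, hm0 1]
      have h1 : m 1 = 0 := by linarith [hm0 0, hm0 1]
      simp [Fin.sum_univ_two, h0, h1]
    · have := hg u z s'
      simp only [posterior, htot, div_mul_eq_mul_div, ← Finset.sum_div] at this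
      exact (div_le_div_iff_of_pos_right h).1 this
  have k0 := key 0
  have k1 := key 1
  simp only [Fin.sum_univ_two, hamming] at k0 k1 ⊢
  generalize g u z = s at k0 k1 ⊢
  fin_cases s
  · simp at k0 k1 ⊢
    exact k1
  · simp at k0 k1 ⊢
    exact k0

/-- The law of the letters is the image of the law of `(U, X, S, N)`; summing over the noise bit
replaces the sum over outputs. -/
theorem example_prob (A : Letters (Fin 3) (Fin 2) (Fin 2) (Fin 2) ↥(sensingAlphabet a) → Prop) :
    prob (jointLaw (exampleChannel q a e hq he) P) A =
      ∑ u, ∑ x, ∑ s, ∑ ν, P (u, x) * bern q s * bern e ν *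
        ind (A (u, x, s, s * x, sensingOutput a x s ν)) := by
  classical
  simp only [prob, Fintype.sum_prod_type]
  refine Finset.sum_congr rfl fun u _ => Finset.sum_congr rfl fun x _ =>
    Finset.sum_congr rfl fun s _ => ?_
  rw [← Fintype.sum_prod_type' (fun y z => if A (u, x, s, y, z) then
    jointLaw (exampleChannel q a e hq he) P (u, x, s, y, z) else 0)]
  have h : ∀ o : Fin 2 × ↥(sensingAlphabet a), (if A (u, x, s, o.1, o.2) then
      jointLaw (exampleChannel q a e hq he) P (u, x, s, o.1, o.2) else 0) =
      ∑ ν, if o = (s * x, sensingOutput a x s ν) then P (u, x) * bern q s * bern e ν *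
        ind (A (u, x, s, o.1, o.2)) else 0 := by
    intro o
    simp only [jointLaw, exampleChannel, exampleW, rvU, rvX, rvS, rvY, rvZ, ind, Finset.mul_sum]
    split_ifs with hA
    · refine Finset.sum_congr rfl fun ν _ => ?_
      split_ifs <;> ring
    · simp
  rw [Finset.sum_congr rfl fun o _ => h o, Finset.sum_comm]
  refine Finset.sum_congr rfl fun ν _ => ?_
  rw [Finset.sum_ite_eq' Finset.univ]
  simp

/-- The joint masses of state, auxiliary letter and sensing output in the example. -/
theorem example_mass (s : Fin 2) (u : Fin 3) (r : ℝ) :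
    prob (jointLaw (exampleChannel q a e hq he) P)
        (fun ω => rvS ω = s ∧ rvU ω = u ∧ Subtype.val (rvZ ω) = r) =
      bern q s * ∑ x, ∑ ν, P (u, x) * bern e ν * ind ((sensingOutput a x s ν : ℝ) = r) := by
  rw [example_prob hq he]
  rw [Finset.sum_eq_single u]
  · rw [Finset.mul_sum]
    refine Finset.sum_congr rfl fun x _ => ?_
    rw [Finset.sum_eq_single s]
    · rw [Finset.mul_sum]
      refine Finset.sum_congr rfl fun ν _ => ?_
      simp only [rvS, rvU, rvZ, true_and]
      ring
    · intro s' _ hs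
      simp [rvS, hs, ind_of_not]
    · simp
  · intro u' _ hu
    simp [rvU, hu, ind_of_not]
  · simp

/-- For `0 < a < 1` the four symbols are distinct, so `Z` is `a` or `a + 1` exactly when `S X = 1`.
Thus these symbols exclude `S = 0`, while `Z` in `{0, 1}` with `S = 1` forces `X = 0`. -/
theorem example_masses (ha : a ∈ Set.Ioo (0 : ℝ) 1) (u : Fin 3) :
    let m := fun (s : Fin 2) (r : ℝ) => prob (jointLaw (exampleChannel q a e hq he) P)
      (fun ω => rvS ω = s ∧ rvU ω = u ∧ Subtype.val (rvZ ω) = r)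
    m 0 0 = (1 - q) * ((1 - e) * P (u, 0) + e * P (u, 1)) ∧ m 1 0 = q * (1 - e) * P (u, 0) ∧
    m 0 1 = (1 - q) * (e * P (u, 0) + (1 - e) * P (u, 1)) ∧ m 1 1 = q * e * P (u, 0) ∧
    m 0 a = 0 ∧ m 0 (a + 1) = 0 := by
  have h1 : a ≠ 0 := ha.1.ne'
  have h2 : a ≠ 1 := ha.2.ne
  have h3 : a + 1 ≠ 0 := by linarith [ha.1]
  simp only [example_mass, Fin.sum_univ_two, sensingOutput, bern, ind]
  refine ⟨?_, ?_, ?_, ?_, ?_, ?_⟩ <;> norm_num [h1, h2, h3, h1.symm, h2.symm, h3.symm]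
  all_goals first | ring1 | exact Or.inl (by ring1)

theorem sum_sensingAlphabet (ha : a ∈ Set.Ioo (0 : ℝ) 1) (F : ℝ → ℝ) :
    ∑ z : ↥(sensingAlphabet a), F z = F 0 + (F 1 + (F a + F (a + 1))) := by
  have h1 := ha.1.ne
  have h2 := ha.2.ne'
  have h3 : (0 : ℝ) ≠ a + 1 := by linarith [ha.1]
  rw [Finset.sum_coe_sort (sensingAlphabet a) F, sensingAlphabet,
    Finset.sum_insert (by simp [h1, h3]), Finset.sum_insert (by simp [h1.symm, h2]),
    Finset.sum_insert (by simp), Finset.sum_singleton]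

/-- The distortion is the sum over `(u, z)` of the smaller joint mass with `S = 0` or `S = 1`. At `z
= a` and `z = a + 1` it is zero; at `z = 0` and `z = 1` it is the mass of the observation, which is
the denominator in `d0` and `d1`, times the MAP error. -/
theorem example_distortion (ha : a ∈ Set.Ioo (0 : ℝ) 1) (hP : P ∈ stdSimplex ℝ (Fin 3 × Fin 2))
    {g : Fin 3 → ↥(sensingAlphabet a) → Fin 2}
    (hg : IsOneShotOptimal (jointLaw (exampleChannel q a e hq he) P) hamming g) :
    expect (jointLaw (exampleChannel q a e hq he) P)
        (fun ω => hamming (rvS ω) (g (rvU ω) (rvZ ω))) =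
      exampleDistortion q a e P (jointLaw (exampleChannel q a e hq he) P) := by
  set L := jointLaw (exampleChannel q a e hq he) P with hLdef
  have hL : ∀ ω, 0 ≤ L ω := (jointLaw_mem (exampleChannel q a e hq he) hP).1
  set m : Fin 3 → Fin 2 → ℝ → ℝ := fun u s r =>
    prob L (fun ω => rvS ω = s ∧ rvU ω = u ∧ Subtype.val (rvZ ω) = r) with hm
  have hm0 : ∀ u s r, 0 ≤ m u s r := fun u s r => Finset.sum_nonneg fun ω _ => by
    split_ifs
    · exact hL ω
    · exact le_rfl
  have hexp : expect L (fun ω => hamming (rvS ω) (g (rvU ω) (rvZ ω))) =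
      ∑ u, ∑ z : ↥(sensingAlphabet a), min (m u 0 z) (m u 1 z) := by
    rw [← expect_triple L rvS rvU rvZ fun s u z => hamming s (g u z), Finset.sum_comm]
    refine Finset.sum_congr rfl fun u _ => ?_
    rw [Finset.sum_comm]
    refine Finset.sum_congr rfl fun z _ => ?_
    rw [optimal_error_mass hL hg]
    simp only [hm, Subtype.ext_iff]
  have htot : ∀ u r, prob L (fun ω => Subtype.val (rvZ ω) = r ∧ rvU ω = u) = m u 0 r + m u 1 r := by
    intro u r
    rw [prob_add_of_binary L rvS]
    simp only [hm, and_comm]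
  rw [hexp, exampleDistortion, ← Finset.sum_add_distrib]
  refine Finset.sum_congr rfl fun u _ => ?_
  obtain ⟨m00, m10, m01, m11, z0, z1⟩ :
      m u 0 0 = (1 - q) * ((1 - e) * P (u, 0) + e * P (u, 1)) ∧ m u 1 0 = q * (1 - e) * P (u, 0) ∧
      m u 0 1 = (1 - q) * (e * P (u, 0) + (1 - e) * P (u, 1)) ∧ m u 1 1 = q * e * P (u, 0) ∧
      m u 0 a = 0 ∧ m u 0 (a + 1) = 0 := example_masses hq he ha u
  rw [sum_sensingAlphabet ha fun r => min (m u 0 r) (m u 1 r), htot, htot]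
  have d0eq : (m u 0 0 + m u 1 0) * d0 q e P u = min (m u 0 0) (m u 1 0) := by
    rw [← mass_mul_map_error (hm0 u 0 0) (hm0 u 1 0), d0]
    have hs : (1 - e) * P (u, 0) + (1 - q) * e * P (u, 1) = m u 0 0 + m u 1 0 := by
      rw [m00, m10]; ring
    rw [hs, ← m10]
  have d1eq : (m u 0 1 + m u 1 1) * d1 q e P u = min (m u 0 1) (m u 1 1) := by
    rw [← mass_mul_map_error (hm0 u 0 1) (hm0 u 1 1), d1]
    have hs : e * P (u, 0) + (1 - q) * (1 - e) * P (u, 1) = m u 0 1 + m u 1 1 := by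
      rw [m01, m11]; ring
    rw [hs, ← m11]
  rw [d0eq, d1eq, z0, z1, min_eq_left (hm0 u 1 a), min_eq_left (hm0 u 1 (a + 1))]
  ring

end Example

end ISAC

theorem corollary3 (q a e : ℝ) (hq : q ∈ Set.Ioo (0 : ℝ) 1) (ha : a ∈ Set.Ioo (0 : ℝ) 1)
    (he : e ∈ Set.Icc (0 : ℝ) 1)
    (P : Fin 3 × Fin 2 → ℝ) (hP : P ∈ stdSimplex ℝ (Fin 3 × Fin 2))
    (ch : ISAC.Channel (Fin 2) (Fin 2) (Fin 2) ↥(ISAC.sensingAlphabet a))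
    (hch : ch = ISAC.exampleChannel q a e (Set.Ioo_subset_Icc_self hq) he)
    (L : ISAC.Letters (Fin 3) (Fin 2) (Fin 2) (Fin 2) ↥(ISAC.sensingAlphabet a) → ℝ)
    (hL : L = ISAC.jointLaw ch P)
    (p IUZ IXYUS D : ℝ)
    (hp : p = ISAC.prob L (fun ω => ISAC.rvX ω = 0))
    (hIUZ : IUZ = ISAC.mutualInfo L ISAC.rvU ISAC.rvZ)
    (hIXYUS : IXYUS = ISAC.condMutualInfo L ISAC.rvX ISAC.rvY
      (fun ω => (ISAC.rvU ω, ISAC.rvS ω)))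
    (hD : D = ISAC.exampleDistortion q a e P L) :
    -- the single-letter quantities of the partial-decoding inner bound in closed form
    ISAC.condMutualInfo L ISAC.rvX ISAC.rvY ISAC.rvS = q * ISAC.H2 p ∧
    (∀ g : Fin 3 → ↥(ISAC.sensingAlphabet a) → Fin 2, ISAC.IsOneShotOptimal L ISAC.hamming g →
      ISAC.expect L (fun ω => ISAC.hamming (ISAC.rvS ω) (g (ISAC.rvU ω) (ISAC.rvZ ω))) = D) ∧
    -- the sum rate is attained by a point of the inner bound
    (∃ R₀ R₁ : ℝ, 0 ≤ R₀ ∧ 0 ≤ R₁ ∧ R₀ ≤ IUZ ∧ R₁ ≤ IXYUS ∧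
      R₀ + R₁ = min (q * ISAC.H2 p) (IUZ + IXYUS) ∧
      (R₀, R₁, D) ∈ ISAC.capacityDistortionRegion ch ISAC.hamming) ∧
    -- and every point of the inner bound belongs to the capacity-distortion region
    (∀ R₀ R₁ : ℝ, 0 ≤ R₀ → 0 ≤ R₁ → R₀ ≤ IUZ → R₁ ≤ IXYUS →
      R₀ + R₁ ≤ min (q * ISAC.H2 p) (IUZ + IXYUS) →
      (R₀, R₁, D) ∈ ISAC.capacityDistortionRegion ch ISAC.hamming) ∧
    -- without passing to the closure if the rate inequalities are strict
    (∀ R₀ R₁ : ℝ, 0 ≤ R₀ → 0 ≤ R₁ → R₀ < IUZ → R₁ < IXYUS → R₀ + R₁ < q * ISAC.H2 p →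
      ISAC.Achievable ch ISAC.hamming R₀ R₁ D) := by
  subst hch hL hp hIUZ hIXYUS hD
  have hq' := Set.Ioo_subset_Icc_self hq
  have hd0 : ∀ s s' : Fin 2, 0 ≤ ISAC.hamming s s' := fun s s' => by
    unfold ISAC.hamming; split_ifs <;> norm_num
  have hd1 : ∀ s s' : Fin 2, ISAC.hamming s s' ≤ 1 := fun s s' => by
    unfold ISAC.hamming; split_ifs <;> norm_num
  have hword := ISAC.example_condMutualInfo (a := a) hq' he hq hP
  have hopt := fun g => ISAC.example_distortion (g := g) hq' he ha hP
  obtain ⟨g, hg⟩ := ISAC.exists_isOneShotOptimal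
    (ISAC.jointLaw (ISAC.exampleChannel q a e hq' he) P) ISAC.hamming
  have hmem := fun (R₀ R₁ : ℝ) (h₀ : 0 ≤ R₀) (h₁ : 0 ≤ R₁) =>
    ISAC.mem_region_of_le (ISAC.exampleChannel q a e hq' he) hP hd0 hd1 g h₀ h₁
  -- Any optimal estimator may be used for coding, since all have the distortion `D`.
  rw [hopt g hg, hword] at hmem
  have hUZ := (ISAC.letterEnsemble (ISAC.exampleChannel q a e hq' he) P hP).cloudInfo_nonneg
  have hXY := (ISAC.letterEnsemble (ISAC.exampleChannel q a e hq' he) P hP).satelliteInfo_nonneg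
  have hW := (ISAC.letterEnsemble (ISAC.exampleChannel q a e hq' he) P hP).wordInfo_nonneg
  rw [← ISAC.mutualInfo_UZ] at hUZ
  rw [← ISAC.condMutualInfo_XY_US] at hXY
  rw [← ISAC.condMutualInfo_XY_S, hword] at hW
  refine ⟨hword, hopt, ?_, fun R₀ R₁ h₀ h₁ h₂ h₃ h₄ =>
    hmem R₀ R₁ h₀ h₁ h₂ h₃ (h₄.trans (min_le_left _ _)), fun R₀ R₁ h₀ h₁ h₂ h₃ h₄ => ?_⟩
  · set I₀ := ISAC.mutualInfo (ISAC.jointLaw (ISAC.exampleChannel q a e hq' he) P)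
      ISAC.rvU ISAC.rvZ
    set I₁ := ISAC.condMutualInfo (ISAC.jointLaw (ISAC.exampleChannel q a e hq' he) P)
      ISAC.rvX ISAC.rvY fun ω => (ISAC.rvU ω, ISAC.rvS ω)
    set I := q * ISAC.H2 (ISAC.prob (ISAC.jointLaw (ISAC.exampleChannel q a e hq' he) P)
      fun ω => ISAC.rvX ω = 0)
    -- The common rate takes as much of the sum rate as `I₀` allows; the rest, at most `I₁`, is the
    -- private rate.
    have hsum : min I₀ (min I (I₀ + I₁)) + (min I (I₀ + I₁) - min I₀ (min I (I₀ + I₁))) =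
        min I (I₀ + I₁) := by ring
    have h0 : 0 ≤ min I₀ (min I (I₀ + I₁)) := le_min hUZ (le_min hW (add_nonneg hUZ hXY))
    have h1 : 0 ≤ min I (I₀ + I₁) - min I₀ (min I (I₀ + I₁)) := sub_nonneg.2 (min_le_right _ _)
    have h2 : min I (I₀ + I₁) - min I₀ (min I (I₀ + I₁)) ≤ I₁ := by
      rcases min_choice I₀ (min I (I₀ + I₁)) with h | h <;> rw [h]
      · linarith [min_le_right I (I₀ + I₁)]
      · linarith
    exact ⟨_, _, h0, h1, min_le_left _ _, h2, hsum, hmem _ _ h0 h1 (min_le_left _ _) h2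
      (hsum.le.trans (min_le_left _ _))⟩
  · rw [← hopt g hg]
    exact ISAC.achievable_of_lt _ hP hd0 hd1 g h₀ h₁ (Or.inr h₂) (Or.inr h₃)
      (Or.inr (by rw [hword]; exact h₄))
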